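/- **Conventions.** For a complex vector space $X$ write $M_\infty(X)=\bigcup_n M_n(X)$ and, for a linear map $\varphi:X\to Y$, $\varphi^{(n)}:=\mathrm{id}_{M_n}\otimes\varphi$ and $\varphi^{(\infty)}:=\mathrm{id}_{M_\infty}\otimes\varphi$. A *semi-matrix ordered operator space* (SMOS) is an operator space $X$ with an involution such that the induced involution on $M_\infty(X)$ is isometric, together with a norm closed cone $M_\infty(X)_+\subseteq M_\infty(X)_{\mathrm{sa}}$ (not necessarily proper) satisfying $\alpha^*x\alpha+\beta^*y\beta\in M_\infty(X)_+$ for $x,y\in M_\infty(X)_+$ and $\alpha,\beta\in M_\infty$. For a complete SMOS $X$, the dual $X^*$ carries the involution $f^*(x)=\overline{f(x^*)}$, the completely bounded matrix norm and the cones $M_n(X^*)_+$ of completely positive maps in $\mathrm{CB}(X,M_n)=M_n(X^*)$, and the weak$^*$-topology $\sigma(X^*,X)$. It is a *dual operator system* if there are a Hilbert space $H$ and a completely order monomorphic complete isometry $\Psi:X^*\to\mathcal B(H)$ that is a weak$^*$-homeomorphism onto its image. $\mathrm{CCP}(E,F)$ denotes the set of completely positive (in particular self-adjoint) complete contractions,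 and $\mathrm{CCP}_w(E,F)$ the set of those that are weak$^*$-continuous. Let $Y$ be a complete SMOS. Let $$N(Y^*):=\bigoplus_{n\in\mathbb N}^{\ell^\infty}\ell^\infty\big(\mathrm{CCP}_w(Y^*,M_n);M_n\big),$$ a von Neumann algebra with predual $\bigoplus_n^{\ell^1}\ell^1(\mathrm{CCP}_w(Y^*,M_n);M_n^*)$, and let $\mu:Y^*\to N(Y^*)$, $\mu(f)=(\psi(f))_\psi$, be the evaluation map. Then $Y^{\mathrm d}$ is the weak$^*$-closure of $\mu(Y^*)$ in $N(Y^*)$, with the induced involution, matrix norm, matrix cone and weak$^*$-topology, and $\iota_{Y^*}:Y^*\to Y^{\mathrm d}$ is the map given by $\mu$. Let $(Y^*)\check{\ }$ be the quotient of $Y^*$ by the null space of $\|f\|^{\mathrm r}:=\sup\{\|\psi^{(\infty)}(f)\|:\psi\in\mathrm{CCP}(Y^*,M_m),\ m\in\mathbb N\}$, with the matrix norm induced by $\|\cdot\|^{\mathrm r}$ and the image of the matrix cone of $Y^*$, and with quotient map $q:Y^*\to (Y^*)\check{\ }$; $\iota_{Y^*}$ induces a canonical map $\kappa:(Y^*)\check{\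 }\to Y^{\mathrm d}$ with $\kappa\circ q=\iota_{Y^*}$. **Theorem.** Let $Y$ be a complete SMOS, let $V$ be a dual operator system and let $\varphi\in\mathrm{CCP}_w(Y^*,V)$. (a) There is a unique linear map $\varphi\check{\ }:(Y^*)\check{\ }\to V$ with $\varphi\check{\ }\circ q=\varphi$; it is a completely positive complete contraction, and it is continuous from the topology induced on $(Y^*)\check{\ }$ by $\kappa$ and the weak$^*$-topology of $Y^{\mathrm d}$ to the weak$^*$-topology of $V$. There is a unique weak$^*$-continuous linear map $\overline\varphi:Y^{\mathrm d}\to V$ with $\overline\varphi\circ\iota_{Y^*}=\varphi$. It satisfies $\overline\varphi\circ\kappa=\varphi\check{\ }$ and $\overline\varphi\in\mathrm{CCP}_w(Y^{\mathrm d},V)$. (b) Suppose that for every $n\in\mathbb N$ and every $\psi\in\mathrm{CCP}_w(Y^*,M_n)$ there is $\hat\psi\in\mathrm{CCP}_w(V,M_n)$ with $\psi=\hat\psi\circ\varphi$. Then $\overline\varphi:Y^{\mathrm d}\to\overline\varphi(Y^{\mathrm d})$ is a complete isometry, a weak$^*$-homeomorphism and a complete order isomorphism. (c) $\iota_{Y^*}^{(\infty)}(M_\infty(Y^*)_+)$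 is weak$^*$-dense in $M_\infty(Y^{\mathrm d})_+$; in fact, for every $n$, the set $\iota_{Y^*}^{(n)}(M_n(Y^*)_+)$ is contained and weak$^*$-dense in $M_n(Y^{\mathrm d})_+$. -/

import Mathlib

open scoped Topology ENNReal ComplexOrder Matrix Matrix.Norms.L2Operator

universe u v w

noncomputable section

/-! ### Matrices over a vector space

`M_∞(X)` is the increasing union of the spaces `M_n(X)`. A norm, a cone or a topology on `M_∞(X)`
is described by its restrictions to the `M_n(X)`, and multiplication by elements of `M_∞` is
described by multiplication by rectangular scalar matrices. -/

/-- The product `α x β ∈ M_n(X)` for `x ∈ M_m(X)` and scalar matrices `α ∈ M_{n,m}`,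
`β ∈ M_{m,n}`. -/
def matSandwich {X : Type*} [AddCommGroup X] [Module ℂ X] {m n : ℕ}
    (α : Matrix (Fin n) (Fin m) ℂ) (x : Matrix (Fin m) (Fin m) X)
    (β : Matrix (Fin m) (Fin n) ℂ) : Matrix (Fin n) (Fin n) X :=
  Matrix.of fun i j => ∑ k, ∑ l, (α i k * β l j) • x k l

/-- The bare data of a matrix norm and of a matrix cone, without any axiom. -/
class MatrixOrderedData (X : Type*) where
  /-- the norm on `M_n(X)` -/
  matNorm : ∀ n : ℕ, Matrix (Fin n) (Fin n) X → ℝ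
  /-- the cone `M_n(X)_+` -/
  matCone : ∀ n : ℕ, Set (Matrix (Fin n) (Fin n) X)

open MatrixOrderedData

/-- A semi-matrix ordered operator space (SMOS): a `*`-operator space together with a norm closed
(not necessarily proper) matrix cone. -/
class SMOS (X : Type*) [NormedAddCommGroup X] [NormedSpace ℂ X] [StarAddMonoid X]
    [StarModule ℂ X] [NormedStarGroup X] extends MatrixOrderedData X where
  /-- the norm of `X` is the norm of `M_1(X)` -/
  matNorm_one : ∀ x : X, matNorm 1 (Matrix.of fun _ _ => x) = ‖x‖
  matNorm_add : ∀ (n : ℕ) (x y : Matrix (Fin n) (Fin n) X),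
    matNorm n (x + y) ≤ matNorm n x + matNorm n y
  matNorm_smul : ∀ (n : ℕ) (c : ℂ) (x : Matrix (Fin n) (Fin n) X),
    matNorm n (c • x) = ‖c‖ * matNorm n x
  eq_zero_of_matNorm : ∀ (n : ℕ) (x : Matrix (Fin n) (Fin n) X), matNorm n x = 0 → x = 0
  /-- Ruan's axiom -/
  matNorm_sandwich_add : ∀ (m k n : ℕ) (x : Matrix (Fin m) (Fin m) X)
    (y : Matrix (Fin k) (Fin k) X)
    (α : Matrix (Fin n) (Fin m) ℂ) (β : Matrix (Fin m) (Fin n) ℂ)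
    (γ : Matrix (Fin n) (Fin k) ℂ) (δ : Matrix (Fin k) (Fin n) ℂ),
    matNorm n (matSandwich α x β + matSandwich γ y δ) ≤
      Real.sqrt ‖α * αᴴ + γ * γᴴ‖ * Real.sqrt ‖βᴴ * β + δᴴ * δ‖ * max (matNorm m x) (matNorm k y)
  matNorm_star : ∀ (n : ℕ) (x : Matrix (Fin n) (Fin n) X), matNorm n xᴴ = matNorm n x
  star_eq_of_mem_matCone : ∀ (n : ℕ) (x : Matrix (Fin n) (Fin n) X), x ∈ matCone n → xᴴ = x
  zero_mem_matCone : ∀ n : ℕ, (0 : Matrix (Fin n) (Fin n) X) ∈ matCone n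
  sandwich_add_mem_matCone : ∀ (m k n : ℕ) (x : Matrix (Fin m) (Fin m) X)
    (y : Matrix (Fin k) (Fin k) X) (α : Matrix (Fin m) (Fin n) ℂ) (β : Matrix (Fin k) (Fin n) ℂ),
    x ∈ matCone m → y ∈ matCone k → matSandwich αᴴ x α + matSandwich βᴴ y β ∈ matCone n
  matCone_closed : ∀ (n : ℕ) (x : Matrix (Fin n) (Fin n) X),
    (∀ ε > 0, ∃ y ∈ matCone n, matNorm n (x - y) < ε) → x ∈ matCone n

/-! ### Maps -/

section Maps

variable {X : Type*} {W : Type*} [AddCommGroup X] [Module ℂ X] [Star X] [MatrixOrderedData X]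
  [AddCommGroup W] [Module ℂ W] [Star W] [MatrixOrderedData W]

/-- Completely positive complete contractions. -/
structure IsCCP (φ : X →ₗ[ℂ] W) : Prop where
  map_star : ∀ x : X, φ (star x) = star (φ x)
  map_matCone : ∀ (n : ℕ) (x : Matrix (Fin n) (Fin n) X), x ∈ matCone n → x.map φ ∈ matCone n
  matNorm_map_le : ∀ (n : ℕ) (x : Matrix (Fin n) (Fin n) X), matNorm n (x.map φ) ≤ matNorm n x

/-- Continuous completely positive complete contractions; `X` and `W` will carry their
weak*-topologies. -/
structure IsCCPw [TopologicalSpace X] [TopologicalSpace W] (φ : X →ₗ[ℂ] W) : Prop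
    extends IsCCP φ where
  continuous : Continuous φ

/-- Complete isometries. -/
def IsCompleteIsometry (φ : X →ₗ[ℂ] W) : Prop :=
  ∀ (n : ℕ) (x : Matrix (Fin n) (Fin n) X), matNorm n (x.map φ) = matNorm n x

/-- Complete order monomorphisms, that is, complete order isomorphisms onto the image, the image
being equipped with the involution and the matrix cone induced from the codomain. -/
structure IsCompleteOrderMono (φ : X →ₗ[ℂ] W) : Prop where
  map_star : ∀ x : X, φ (star x) = star (φ x)
  injective : Function.Injective φ
  mem_matCone_iff : ∀ (n : ℕ) (x : Matrix (Fin n) (Fin n) X), xᴴ = x →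
    (x.map φ ∈ matCone n ↔ x ∈ matCone n)

end Maps

/-! ### The basic examples: `M_n` and `B(H)` -/

/-- `M_n` with its usual matrix norm and matrix cone, through `M_m(M_n) = M_{mn}`. -/
instance matrixMatrixOrderedData (n : ℕ) : MatrixOrderedData (Matrix (Fin n) (Fin n) ℂ) where
  matNorm m x := ‖Matrix.comp (Fin m) (Fin m) (Fin n) (Fin n) ℂ x‖
  matCone m := {x | (Matrix.comp (Fin m) (Fin m) (Fin n) (Fin n) ℂ x).PosSemidef}

section Hilbert

variable (H : Type*) [NormedAddCommGroup H] [InnerProductSpace ℂ H]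

/-- The operator on `H ⊕ ⋯ ⊕ H` given by a matrix of operators on `H`. -/
def matOp {n : ℕ} (T : Matrix (Fin n) (Fin n) (H →L[ℂ] H)) :
    PiLp 2 (fun _ : Fin n => H) →L[ℂ] PiLp 2 (fun _ : Fin n => H) :=
  (PiLp.continuousLinearEquiv 2 ℂ (fun _ : Fin n => H)).symm.toContinuousLinearMap ∘L
    (ContinuousLinearMap.pi fun i => ∑ j, T i j ∘L ContinuousLinearMap.proj j) ∘L
    (PiLp.continuousLinearEquiv 2 ℂ (fun _ : Fin n => H)).toContinuousLinearMap

/-- `B(H)` with its usual matrix norm and matrix cone. -/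
instance operatorMatrixOrderedData : MatrixOrderedData (H →L[ℂ] H) where
  matNorm _ T := ‖matOp H T‖
  matCone _ := {T | (matOp H T).IsPositive}

/-- The ultraweak (that is, weak*-) topology of `B(H)`: the weakest topology for which the maps
`T ↦ ∑ᵢ ⟪ηᵢ, T ξᵢ⟫` are continuous, where `ξ` and `η` are square summable sequences in `H`. -/
abbrev ultraweakTopology : TopologicalSpace (H →L[ℂ] H) :=
  TopologicalSpace.induced
    (fun (T : H →L[ℂ] H) (p : lp (fun _ : ℕ => H) 2 × lp (fun _ : ℕ => H) 2) =>
      ∑' i, inner ℂ (p.2 i) (T (p.1 i)))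
    inferInstance

end Hilbert

/-! ### Dual spaces -/

section Dual

variable (Y : Type u) [NormedAddCommGroup Y] [NormedSpace ℂ Y] [StarAddMonoid Y]
  [StarModule ℂ Y] [NormedStarGroup Y]

/-- The involution `f^*(x) = conj (f (x^*))` of the dual space. -/
def dualStar (f : WeakDual ℂ Y) : WeakDual ℂ Y :=
  StrongDual.toWeakDual
    (((starL ℂ : ℂ ≃L⋆[ℂ] ℂ) : ℂ →L⋆[ℂ] ℂ).comp
      ((WeakDual.toStrongDual f).comp ((starL ℂ : Y ≃L⋆[ℂ] Y) : Y →L⋆[ℂ] Y)))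

theorem dualStar_apply (f : WeakDual ℂ Y) (y : Y) : dualStar Y f y = star (f (star y)) := rfl

instance weakDualStarAddMonoid : StarAddMonoid (WeakDual ℂ Y) where
  star := dualStar Y
  star_involutive f := by
    refine DFunLike.ext _ _ fun y => ?_
    simp [dualStar_apply]
  star_add f g := by
    refine DFunLike.ext _ _ fun y => ?_
    change star (f (star y) + g (star y)) = star (f (star y)) + star (g (star y))
    exact star_add _ _

variable {Y} in
/-- The matrix `f^{(m)}(x) ∈ M_m(M_n) = M_{mn}` for `f ∈ M_n(Y^*)` and `x ∈ M_m(Y)`. -/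
def matEval {m n : ℕ} (f : Matrix (Fin n) (Fin n) (WeakDual ℂ Y))
    (x : Matrix (Fin m) (Fin m) Y) : Matrix (Fin m × Fin n) (Fin m × Fin n) ℂ :=
  Matrix.of fun p q => f p.2 q.2 (x p.1 q.1)

/-- The dual matrix norm and the dual matrix cone on `Y^*`; the type `WeakDual ℂ Y` is `Y^*`
equipped with the weak*-topology `σ(Y^*, Y)`. -/
instance weakDualMatrixOrderedData [MatrixOrderedData Y] : MatrixOrderedData (WeakDual ℂ Y) where
  matNorm _ f := sSup {r : ℝ | ∃ (m : ℕ) (x : Matrix (Fin m) (Fin m) Y),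
    matNorm m x ≤ 1 ∧ r = ‖matEval f x‖}
  matCone _ := {f | fᴴ = f ∧ ∀ (m : ℕ) (x : Matrix (Fin m) (Fin m) Y), x ∈ matCone m →
    (matEval f x).PosSemidef}

/-- The dual SMOS `Y^*`, equipped with `σ(Y^*, Y)`, is a dual operator system: for some Hilbert
space `H` there is a completely order monomorphic complete isometry `Ψ : Y^* → B(H)` which is a
homeomorphism onto its image for the weak*-topologies (in particular the matrix cone of `Y^*` is
then proper). -/
def IsDualOperatorSystem [MatrixOrderedData Y] : Prop :=
  ∃ (H : Type w) (_ : NormedAddCommGroup H) (_ : InnerProductSpace ℂ H) (_ : CompleteSpace H)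
    (Ψ : WeakDual ℂ Y →ₗ[ℂ] (H →L[ℂ] H)),
    IsCompleteOrderMono Ψ ∧ IsCompleteIsometry Ψ ∧
    @Topology.IsEmbedding _ _ inferInstance (ultraweakTopology H) Ψ

end Dual

/-! ### The regularization `X ˇ` -/

section Regularization

variable (X : Type*) [AddCommGroup X] [Module ℂ X] [StarAddMonoid X] [MatrixOrderedData X]

/-- The common kernel of all completely positive complete contractions from `X` to the `M_m`. -/
def regKernel : Submodule ℂ X :=
  ⨅ (m : ℕ) (ψ : {ψ : X →ₗ[ℂ] Matrix (Fin m) (Fin m) ℂ // IsCCP ψ}), LinearMap.ker ψ.1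

variable {X} in
theorem regKernel_le {m : ℕ} {ψ : X →ₗ[ℂ] Matrix (Fin m) (Fin m) ℂ} (hψ : IsCCP ψ) :
    regKernel X ≤ LinearMap.ker ψ :=
  (iInf_le _ m).trans
    (iInf_le (fun ψ : {ψ : X →ₗ[ℂ] Matrix (Fin m) (Fin m) ℂ // IsCCP ψ} => LinearMap.ker ψ.1)
      ⟨ψ, hψ⟩)

variable {X} in
theorem star_mem_regKernel {x : X} (hx : x ∈ regKernel X) : star x ∈ regKernel X := by
  simp only [regKernel, Submodule.mem_iInf, LinearMap.mem_ker] at hx ⊢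
  intro m ψ
  rw [ψ.2.map_star, hx m ψ, star_zero]

/-- The regularization of `X`. -/
def Regularization : Type _ := X ⧸ regKernel X

instance : AddCommGroup (Regularization X) := inferInstanceAs (AddCommGroup (X ⧸ regKernel X))

instance : Module ℂ (Regularization X) := inferInstanceAs (Module ℂ (X ⧸ regKernel X))

/-- The quotient map of `X` onto its regularization. -/
def toRegularization : X →ₗ[ℂ] Regularization X := (regKernel X).mkQ

variable {X} in
/-- The map on the regularization of `X` which is induced by a linear map vanishing on the
kernel. -/
def regLift {W : Type*} [AddCommGroup W] [Module ℂ W] (ψ : X →ₗ[ℂ] W)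
    (hψ : regKernel X ≤ LinearMap.ker ψ) : Regularization X →ₗ[ℂ] W :=
  (regKernel X).liftQ ψ hψ

instance : Star (Regularization X) where
  star := Quotient.map' star fun x y h => by
    rw [Submodule.quotientRel_def] at h ⊢
    rw [← star_sub]
    exact star_mem_regKernel h

theorem toRegularization_star (x : X) :
    toRegularization X (star x) = star (toRegularization X x) := rfl

/-- The matrix norm of the regularization is induced by the matrix semi-norm
`‖x‖^r = sup {‖ψ^{(n)}(x)‖ : ψ ∈ CCP(X, M_m), m ∈ ℕ}` on `X`, and its matrix cone is the image of
the matrix cone of `X`. -/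
instance regularizationMatrixOrderedData : MatrixOrderedData (Regularization X) where
  matNorm n x := sSup {r : ℝ | ∃ (m : ℕ) (ψ : X →ₗ[ℂ] Matrix (Fin m) (Fin m) ℂ) (hψ : IsCCP ψ),
    r = matNorm n (x.map (regLift ψ (regKernel_le hψ)))}
  matCone n := (fun x : Matrix (Fin n) (Fin n) X => x.map (toRegularization X)) '' matCone n

end Regularization

/-! ### The von Neumann algebra `N(Y^*)` and the dual operator system `Y^d` -/

section UniversalDual

variable (Y : Type u) [NormedAddCommGroup Y] [NormedSpace ℂ Y] [StarAddMonoid Y]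
  [StarModule ℂ Y] [NormedStarGroup Y] [MatrixOrderedData Y]

/-- The disjoint union over `n` of the sets of weak*-continuous completely positive complete
contractions from `Y^*` to `M_n`. -/
abbrev CCPwIndex : Type u :=
  Σ n : ℕ, {ψ : WeakDual ℂ Y →ₗ[ℂ] Matrix (Fin n) (Fin n) ℂ // IsCCPw ψ}

/-- The underlying space of `N(Y^*)`, the `ℓ^∞`-direct sum of copies of `M_n` indexed by the
weak*-continuous completely positive complete contractions `ψ : Y^* → M_n`, `n ∈ ℕ`. -/
abbrev NSpace : Type u := lp (fun i : CCPwIndex Y => Matrix (Fin i.1) (Fin i.1) ℂ) ∞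

/-- The predual of `N(Y^*)`, the `ℓ^1`-direct sum of the corresponding spaces `M_n^*`. -/
abbrev NPredual : Type u :=
  lp (fun i : CCPwIndex Y => StrongDual ℂ (Matrix (Fin i.1) (Fin i.1) ℂ)) 1

variable {Y} in
theorem summable_pairing (x : NSpace Y) (ω : NPredual Y) : Summable fun i => ω i (x i) := by
  have h1 : Summable fun i => ‖ω i‖ := by
    simpa using (lp.memℓp ω).summable (by simp)
  refine Summable.of_norm_bounded (h1.mul_right ‖x‖) fun i => ?_
  exact ((ω i).le_opNorm (x i)).trans
    (mul_le_mul_of_nonneg_left (lp.norm_apply_le_norm (by simp) x i) (norm_nonneg _))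

/-- The pairing of `N(Y^*)` with its predual. -/
def nPairing : NSpace Y →ₗ[ℂ] NPredual Y →ₗ[ℂ] ℂ :=
  LinearMap.mk₂ ℂ (fun x ω => ∑' i, ω i (x i))
    (fun x x' ω => by
      rw [← (summable_pairing x ω).tsum_add (summable_pairing x' ω)]
      simp)
    (fun c x ω => by
      rw [smul_eq_mul, ← tsum_mul_left]
      simp)
    (fun x ω ω' => by
      rw [← (summable_pairing x ω).tsum_add (summable_pairing x ω')]
      simp)
    (fun c x ω => by
      rw [smul_eq_mul, ← tsum_mul_left]
      simp)

/-- The von Neumann algebra `N(Y^*)`, equipped with its weak*-topology. -/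
abbrev NAlg : Type u := WeakBilin (nPairing Y)

/-- The coordinate of an element of `N(Y^*)` at the index `i`. -/
def NAlg.coord (i : CCPwIndex Y) : NAlg Y →ₗ[ℂ] Matrix (Fin i.1) (Fin i.1) ℂ where
  toFun := fun (x : NSpace Y) => x i
  map_add' _ _ := rfl
  map_smul' _ _ := rfl

variable {Y} in
theorem NAlg.ext_coord {x y : NAlg Y} (h : ∀ i, NAlg.coord Y i x = NAlg.coord Y i y) : x = y :=
  lp.ext (funext h)

instance nAlgStar : Star (NAlg Y) := inferInstanceAs (Star (NSpace Y))

theorem NAlg.coord_star (i : CCPwIndex Y) (x : NAlg Y) :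
    NAlg.coord Y i (star x) = star (NAlg.coord Y i x) := rfl

variable {Y} in
theorem memℓp_predualStar (ω : NPredual Y) :
    Memℓp (fun i : CCPwIndex Y => (((starL ℂ : ℂ ≃L⋆[ℂ] ℂ) : ℂ →L⋆[ℂ] ℂ).comp
      ((ω i).comp ((starL ℂ : Matrix (Fin i.1) (Fin i.1) ℂ ≃L⋆[ℂ] Matrix (Fin i.1) (Fin i.1) ℂ) :
        Matrix (Fin i.1) (Fin i.1) ℂ →L⋆[ℂ] Matrix (Fin i.1) (Fin i.1) ℂ)) :
      StrongDual ℂ (Matrix (Fin i.1) (Fin i.1) ℂ))) 1 := by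
  have h1 : Summable fun i => ‖ω i‖ := by
    simpa using (lp.memℓp ω).summable (by simp)
  refine memℓp_gen ?_
  simp only [ENNReal.toReal_one, Real.rpow_one]
  refine Summable.of_nonneg_of_le (fun _ => norm_nonneg _) (fun i => ?_) h1
  refine ContinuousLinearMap.opNorm_le_bound _ (norm_nonneg _) fun a => ?_
  have h := (ω i).le_opNorm (star a)
  rw [norm_star] at h
  change ‖star (ω i (star a))‖ ≤ _
  rwa [norm_star]

theorem NAlg.continuous_star : Continuous (star : NAlg Y → NAlg Y) := by
  refine WeakBilin.continuous_of_continuous_eval _ fun ω => ?_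
  have h := (WeakBilin.eval_continuous (nPairing Y) (⟨_, memℓp_predualStar ω⟩ : NPredual Y)).star
  refine h.congr fun x => ?_
  change star (∑' i, star (ω i (star (NAlg.coord Y i x)))) = ∑' i, ω i (star (NAlg.coord Y i x))
  rw [tsum_star]
  simp only [star_star]

/-- `N(Y^*)` with the usual matrix norm and matrix cone of an `ℓ^∞`-direct sum. -/
instance nAlgMatrixOrderedData : MatrixOrderedData (NAlg Y) where
  matNorm n x := ⨆ i, matNorm n (x.map (NAlg.coord Y i))
  matCone n := {x | ∀ i, x.map (NAlg.coord Y i) ∈ matCone n}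

theorem norm_le_matNorm_one {n : ℕ} (a : Matrix (Fin n) (Fin n) ℂ) :
    ‖a‖ ≤ matNorm 1 (Matrix.of fun _ _ => a : Matrix (Fin 1) (Fin 1) (Matrix (Fin n) (Fin n) ℂ)) := by
  set A : Matrix (Fin 1 × Fin n) (Fin 1 × Fin n) ℂ :=
    Matrix.comp (Fin 1) (Fin 1) (Fin n) (Fin n) ℂ (Matrix.of fun _ _ => a) with hA
  change ‖a‖ ≤ ‖A‖
  let P : Matrix (Fin 1 × Fin n) (Fin n) ℂ := Matrix.of fun p j => if p.2 = j then 1 else 0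
  have h1 : a = Pᴴ * A * P := by
    ext i j
    simp [P, hA, Matrix.mul_apply, Fintype.sum_prod_type, Matrix.comp_apply, apply_ite]
  have h2 : Pᴴ * P = 1 := by
    ext i j
    simp [P, Matrix.mul_apply, Fintype.sum_prod_type, Matrix.one_apply, apply_ite, eq_comm]
  have h3 : ‖P‖ * ‖P‖ ≤ 1 := by
    rw [← Matrix.l2_opNorm_conjTranspose_mul_self, h2, ← Matrix.diagonal_one,
      Matrix.l2_opNorm_diagonal]
    exact (pi_norm_le_iff_of_nonneg zero_le_one).2 fun _ => by simp
  calc ‖a‖ = ‖Pᴴ * A * P‖ := by rw [← h1]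
    _ ≤ ‖Pᴴ * A‖ * ‖P‖ := Matrix.l2_opNorm_mul _ _
    _ ≤ ‖Pᴴ‖ * ‖A‖ * ‖P‖ :=
      mul_le_mul_of_nonneg_right (Matrix.l2_opNorm_mul _ _) (norm_nonneg _)
    _ = (‖P‖ * ‖P‖) * ‖A‖ := by rw [Matrix.l2_opNorm_conjTranspose]; ring
    _ ≤ 1 * ‖A‖ := mul_le_mul_of_nonneg_right h3 (norm_nonneg _)
    _ = ‖A‖ := one_mul _

variable {Y} in
theorem memℓp_eval (f : WeakDual ℂ Y) :
    Memℓp (fun i : CCPwIndex Y => (i.2.1 f : Matrix (Fin i.1) (Fin i.1) ℂ)) ∞ := by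
  refine memℓp_infty ⟨matNorm 1 (Matrix.of fun _ _ => f), ?_⟩
  rintro _ ⟨i, rfl⟩
  exact (norm_le_matNorm_one _).trans (i.2.2.matNorm_map_le 1 (Matrix.of fun _ _ => f))

/-- The evaluation map `μ : Y^* → N(Y^*)`, `f ↦ (ψ(f))_ψ`. -/
def muMap : WeakDual ℂ Y →ₗ[ℂ] NAlg Y where
  toFun f := (⟨fun i => i.2.1 f, memℓp_eval f⟩ : NSpace Y)
  map_add' f g := NAlg.ext_coord fun i => map_add i.2.1 f g
  map_smul' c f := NAlg.ext_coord fun i => map_smul i.2.1 c f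

theorem NAlg.coord_muMap (i : CCPwIndex Y) (f : WeakDual ℂ Y) :
    NAlg.coord Y i (muMap Y f) = i.2.1 f := rfl

theorem muMap_star (f : WeakDual ℂ Y) : muMap Y (star f) = star (muMap Y f) :=
  NAlg.ext_coord fun i => i.2.2.map_star f

/-- The dual operator system `Y^d`: the weak*-closure of `μ(Y^*)` in `N(Y^*)`, with the induced
structure. -/
def UniversalDual : Submodule ℂ (NAlg Y) := (LinearMap.range (muMap Y)).topologicalClosure

theorem star_mem_universalDual {x : NAlg Y} (hx : x ∈ UniversalDual Y) :
    star x ∈ UniversalDual Y := by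
  refine map_mem_closure (NAlg.continuous_star Y) hx ?_
  rintro _ ⟨f, rfl⟩
  exact ⟨star f, muMap_star Y f⟩

instance universalDualStar : Star (UniversalDual Y) where
  star x := ⟨star x.1, star_mem_universalDual Y x.2⟩

instance universalDualMatrixOrderedData : MatrixOrderedData (UniversalDual Y) where
  matNorm n x := matNorm n (x.map (UniversalDual Y).subtype)
  matCone n := {x | x.map (UniversalDual Y).subtype ∈ matCone n}

/-- The canonical map `ι : Y^* → Y^d`. -/
def iotaMap : WeakDual ℂ Y →ₗ[ℂ] UniversalDual Y :=
  (muMap Y).codRestrict (UniversalDual Y) fun f =>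
    (LinearMap.range (muMap Y)).le_topologicalClosure ⟨f, rfl⟩

theorem regKernel_le_ker_iotaMap : regKernel (WeakDual ℂ Y) ≤ LinearMap.ker (iotaMap Y) :=
  fun _ hf => LinearMap.mem_ker.2 <| Subtype.ext <| NAlg.ext_coord fun i =>
    regKernel_le i.2.2.toIsCCP hf

/-- The canonical map `(Y^*)ˇ → Y^d` on the regularization of `Y^*`, induced by `ι`. -/
def regToUniversalDual : Regularization (WeakDual ℂ Y) →ₗ[ℂ] UniversalDual Y :=
  regLift (iotaMap Y) (regKernel_le_ker_iotaMap Y)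

end UniversalDual

end

/-!
The proof rests on three facts.

*Compressions.* For an orthonormal family `w` in a Hilbert space `H` the compression
`T ↦ (⟪wₖ, T wₗ⟫)` is a completely positive complete contraction from `B(H)` to `M_m`, and these
compressions detect the norm and the positivity of matrices over `B(H)`
(`matNorm_le_of_compress`, `mem_matCone_of_compress`), because finitely many vectors lie in the span
of a finite orthonormal family. If `Ψ` embeds `V` into `B(H)`, the compressions of `Ψ ∘ φ` are
completely positive complete contractions on `Y^*`. Hence `φ` vanishes on the kernel of the
regularization and the induced map is a completely positive complete contraction. For a
weak*-continuous `φ` these compressions are coordinates of `N(Y^*)`, so that by density the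
compressions of `Ψ ∘ φb` are coordinate maps, which makes `φb` a completely positive complete
contraction (`isCCPw_of_comp_iotaMap`).

*Predual elements.* Evaluation at `z` in the predual `Z` of `V` is a finite combination of
functionals `∑ᵢ ⟪ηᵢ, Ψ(·) ξᵢ⟫`. Each `⟪ηᵢ, Ψ(φ(·)) ξᵢ⟫` factors through a coordinate of `N(Y^*)`
with norm at most `‖ηᵢ‖ ‖ξᵢ‖`, so `f ↦ φ(f)(z)` is the restriction to `Y^*` of some `ω_z` in the
predual of `N(Y^*)`. The open mapping theorem provides `‖ω_z‖ ≤ C ‖z‖`, and `x ↦ (z ↦ ⟨x, ω_z⟩)` is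
the extension `φb` (`exists_continuous_extension`). Conversely,
`exists_eval_eq_tsum` represents an absolutely summable combination of coefficients of
weak*-continuous complete contractions on a dual space by a norm convergent series in the predual.
This gives the weak*-continuity of `ι`, and, when all coordinates of `N(Y^*)` lift along `φ`, that
`φb` is a weak*-homeomorphism onto its image (`isEmbedding_of_coord_factor`).

*Bipolar argument.* If an element of `M_n(Y^d)_+` were not in the weak*-closure of the image of
`M_n(Y^*)_+`, a separating functional would restrict to some `y ∈ M_n(Y)` whose symmetrization is
nonnegative on `M_n(Y^*)_+`. As `M_n(Y)_+` is closed, the bipolar theorem `mem_matCone_of_dual`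
puts the symmetrization in `M_n(Y)_+`, so, after scaling, `f ↦ (f(y_ij + y_ji^*))` is one of the
coordinates of `N(Y^*)`. Its positivity contradicts the separation (`matCone_subset_closure`).
-/

open MatrixOrderedData

/-! ### Compressions of Hilbert space operators -/

section HilbertSpace

variable {E : Type*} [NormedAddCommGroup E] [InnerProductSpace ℂ E]

theorem opNorm_le_of_norm_inner_le (T : E →L[ℂ] E) {C : ℝ} (hC : 0 ≤ C)
    (h : ∀ x y : E, ‖inner ℂ x (T y)‖ ≤ C * ‖x‖ * ‖y‖) : ‖T‖ ≤ C := by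
  refine T.opNorm_le_bound hC fun y => ?_
  have h1 := h (T y) y
  rw [inner_self_eq_norm_sq_to_K, norm_pow, RCLike.norm_ofReal, abs_norm] at h1
  rcases (norm_nonneg (T y)).eq_or_lt with h0 | h0
  · rw [← h0]; positivity
  · refine le_of_mul_le_mul_left ?_ h0
    linarith

theorem norm_inner_apply_le (T : E →L[ℂ] E) (x y : E) :
    ‖inner ℂ x (T y)‖ ≤ ‖T‖ * ‖x‖ * ‖y‖ :=
  calc ‖inner ℂ x (T y)‖ ≤ ‖x‖ * ‖T y‖ := norm_inner_le_norm _ _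
    _ ≤ ‖x‖ * (‖T‖ * ‖y‖) := by gcongr; exact T.le_opNorm y
    _ = ‖T‖ * ‖x‖ * ‖y‖ := by ring

theorem isPositive_iff_inner_nonneg (T : E →L[ℂ] E) :
    T.IsPositive ↔ ∀ x, 0 ≤ inner ℂ x (T x) := by
  rw [ContinuousLinearMap.isPositive_iff_complex]
  refine forall_congr' fun x => ?_
  rw [← inner_conj_symm x (T x), starRingEnd_apply, star_nonneg_iff, Complex.nonneg_iff]
  constructor
  · rintro ⟨h1, h2⟩
    exact ⟨h2, by rw [← h1]; simp⟩
  · rintro ⟨h1, h2⟩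
    exact ⟨Complex.ext (by simp) (by simpa using h2), h1⟩

variable {ι : Type*} [Fintype ι] [DecidableEq ι]

theorem inner_toEuclideanCLM_eq_sum (A : Matrix ι ι ℂ) (x y : EuclideanSpace ℂ ι) :
    inner ℂ x (Matrix.toEuclideanCLM (𝕜 := ℂ) A y) =
      ∑ p, ∑ q, star (x p) * A p q * y q := by
  rw [PiLp.inner_apply]
  refine Finset.sum_congr rfl fun p _ => ?_
  rw [RCLike.inner_apply, Matrix.ofLp_toEuclideanCLM, Matrix.mulVec, dotProduct, Finset.sum_mul]
  exact Finset.sum_congr rfl fun q _ => by rw [starRingEnd_apply]; ring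

theorem posSemidef_iff_inner_nonneg (A : Matrix ι ι ℂ) :
    A.PosSemidef ↔ ∀ x : EuclideanSpace ℂ ι,
      0 ≤ inner ℂ x (Matrix.toEuclideanCLM (𝕜 := ℂ) A x) := by
  rw [← isPositive_iff_inner_nonneg, ← Matrix.isPositive_toEuclideanLin_iff,
    ← ContinuousLinearMap.isPositive_toLinearMap_iff, Matrix.coe_toEuclideanCLM_eq_toEuclideanLin]

/-- The compression `T ↦ (⟪wₖ, T wₗ⟫)ₖₗ` of operators to the span of finitely many vectors. -/
noncomputable def compress {m : ℕ} (w : Fin m → E) :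
    (E →L[ℂ] E) →ₗ[ℂ] Matrix (Fin m) (Fin m) ℂ where
  toFun T := Matrix.of fun k l => inner ℂ (w k) (T (w l))
  map_add' S T := by ext; simp
  map_smul' c T := by ext; simp

theorem compress_apply {m : ℕ} (w : Fin m → E) (T : E →L[ℂ] E) (k l : Fin m) :
    compress w T k l = inner ℂ (w k) (T (w l)) := rfl

/-- The vector of `E ⊕ ⋯ ⊕ E` whose components have the coordinates `a (i, ·)` with respect to
`w`. -/
noncomputable def amplify {n m : ℕ} (w : Fin m → E) (a : EuclideanSpace ℂ (Fin n × Fin m)) :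
    PiLp 2 (fun _ : Fin n => E) :=
  WithLp.toLp 2 fun i => ∑ k, a (i, k) • w k

theorem norm_amplify {n m : ℕ} {w : Fin m → E} (hw : Orthonormal ℂ w)
    (a : EuclideanSpace ℂ (Fin n × Fin m)) : ‖amplify w a‖ = ‖a‖ := by
  have h : ∀ i, ‖∑ k, a (i, k) • w k‖ ^ 2 = ∑ k, ‖a (i, k)‖ ^ 2 := fun i => by
    have h1 := hw.inner_sum (fun k => a (i, k)) (fun k => a (i, k)) Finset.univ
    rw [inner_self_eq_norm_sq_to_K] at h1
    have h2 : ((‖∑ k, a (i, k) • w k‖ ^ 2 : ℝ) : ℂ) = ((∑ k, ‖a (i, k)‖ ^ 2 : ℝ) : ℂ) := by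
      push_cast
      rw [show ((‖∑ k, a (i, k) • w k‖ : ℝ) : ℂ) ^ 2 = _ from h1]
      exact Finset.sum_congr rfl fun k _ => by
        rw [RCLike.conj_mul]; rfl
    exact_mod_cast h2
  rw [PiLp.norm_eq_of_L2, EuclideanSpace.norm_eq, Fintype.sum_prod_type]
  exact congrArg Real.sqrt (Finset.sum_congr rfl fun i _ => h i)

/-- Finitely many vectors have coordinates with respect to a finite orthonormal family. -/
theorem exists_amplify_eq {n : ℕ} (x y : PiLp 2 (fun _ : Fin n => E)) :
    ∃ (m : ℕ) (w : Fin m → E) (a b : EuclideanSpace ℂ (Fin n × Fin m)),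
      Orthonormal ℂ w ∧ amplify w a = x ∧ amplify w b = y := by
  let F : Submodule ℂ E := Submodule.span ℂ (Set.range x.ofLp ∪ Set.range y.ofLp)
  have hF : FiniteDimensional ℂ F :=
    FiniteDimensional.span_of_finite ℂ ((Set.finite_range _).union (Set.finite_range _))
  let e := stdOrthonormalBasis ℂ F
  have key : ∀ v ∈ F, ∑ k, inner ℂ (e k : E) v • (e k : E) = v := fun v hv => by
    have h := congrArg Subtype.val (e.sum_repr' ⟨v, hv⟩)
    simpa using h
  refine ⟨_, fun k => (e k : E), WithLp.toLp 2 fun p => inner ℂ (e p.2 : E) (x p.1),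
    WithLp.toLp 2 fun p => inner ℂ (e p.2 : E) (y p.1), ?_, ?_, ?_⟩
  · exact e.orthonormal.comp_linearIsometry F.subtypeₗᵢ
  · refine PiLp.ext fun i => key _ (Submodule.subset_span (Or.inl ⟨i, rfl⟩))
  · refine PiLp.ext fun i => key _ (Submodule.subset_span (Or.inr ⟨i, rfl⟩))

theorem inner_matOp {n : ℕ} (T : Matrix (Fin n) (Fin n) (E →L[ℂ] E))
    (x y : PiLp 2 (fun _ : Fin n => E)) :
    inner ℂ x (matOp E T y) = ∑ i, ∑ j, inner ℂ (x i) (T i j (y j)) := by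
  simp [PiLp.inner_apply, matOp, inner_sum]

theorem inner_compress {n m : ℕ} (w : Fin m → E) (T : Matrix (Fin n) (Fin n) (E →L[ℂ] E))
    (a b : EuclideanSpace ℂ (Fin n × Fin m)) :
    inner ℂ a (Matrix.toEuclideanCLM (𝕜 := ℂ)
      (Matrix.comp (Fin n) (Fin n) (Fin m) (Fin m) ℂ (T.map (compress w))) b) =
      inner ℂ (amplify w a) (matOp E T (amplify w b)) := by
  rw [inner_toEuclideanCLM_eq_sum, inner_matOp]
  simp only [amplify, map_sum, map_smul, sum_inner, inner_sum, inner_smul_left, inner_smul_right,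
    Fintype.sum_prod_type, Matrix.comp_apply, Matrix.map_apply, compress_apply]
  refine Finset.sum_congr rfl fun i _ => ?_
  rw [Finset.sum_comm]
  refine Finset.sum_congr rfl fun j _ => Finset.sum_comm.trans ?_
  refine Finset.sum_congr rfl fun k _ => ?_
  rw [Finset.mul_sum]
  refine Finset.sum_congr rfl fun l _ => ?_
  rw [starRingEnd_apply]
  ring

/-- Compressions to orthonormal families are completely positive complete contractions. -/
theorem isCCP_compress [CompleteSpace E] {m : ℕ} {w : Fin m → E} (hw : Orthonormal ℂ w) :
    IsCCP (compress w) where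
  map_star T := by
    ext k l
    rw [Matrix.star_apply, compress_apply, compress_apply, ContinuousLinearMap.star_eq_adjoint,
      ContinuousLinearMap.adjoint_inner_right]
    exact (inner_conj_symm _ _).symm
  map_matCone n T hT := by
    refine (posSemidef_iff_inner_nonneg _).2 fun a => ?_
    rw [inner_compress]
    exact (isPositive_iff_inner_nonneg _).1 hT _
  matNorm_map_le n T := by
    refine opNorm_le_of_norm_inner_le (Matrix.toEuclideanCLM (𝕜 := ℂ)
      (Matrix.comp (Fin n) (Fin n) (Fin m) (Fin m) ℂ (T.map (compress w)))) (norm_nonneg _)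
      fun a b => ?_
    rw [inner_compress, ← norm_amplify hw a, ← norm_amplify hw b]
    exact norm_inner_apply_le _ _ _

/-- The norm of a matrix of operators is determined by its compressions. -/
theorem matNorm_le_of_compress {n : ℕ} (T : Matrix (Fin n) (Fin n) (E →L[ℂ] E)) {C : ℝ}
    (hC : 0 ≤ C) (h : ∀ (m : ℕ) (w : Fin m → E), Orthonormal ℂ w →
      matNorm n (T.map (compress w)) ≤ C) : matNorm n T ≤ C := by
  refine opNorm_le_of_norm_inner_le _ hC fun x y => ?_
  obtain ⟨m, w, a, b, hw, rfl, rfl⟩ := exists_amplify_eq x y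
  rw [← inner_compress, norm_amplify hw, norm_amplify hw]
  refine (norm_inner_apply_le _ _ _).trans ?_
  gcongr
  exact h m w hw

/-- The positivity of a matrix of operators is determined by its compressions. -/
theorem mem_matCone_of_compress {n : ℕ} (T : Matrix (Fin n) (Fin n) (E →L[ℂ] E))
    (h : ∀ (m : ℕ) (w : Fin m → E), Orthonormal ℂ w → T.map (compress w) ∈ matCone n) :
    T ∈ matCone n := by
  refine (isPositive_iff_inner_nonneg _).2 fun x => ?_
  obtain ⟨m, w, a, b, hw, rfl, -⟩ := exists_amplify_eq x x
  rw [← inner_compress]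
  exact (posSemidef_iff_inner_nonneg _).1 (h m w hw) a

theorem ext_compress {S T : E →L[ℂ] E}
    (h : ∀ (m : ℕ) (w : Fin m → E), Orthonormal ℂ w → compress w S = compress w T) : S = T := by
  refine ContinuousLinearMap.ext fun y => ext_inner_left ℂ fun x => ?_
  obtain ⟨m, w, a, b, hw, hx, hy⟩ := exists_amplify_eq
    (WithLp.toLp 2 fun _ : Fin 1 => x) (WithLp.toLp 2 fun _ : Fin 1 => y)
  have h1 := inner_compress w (Matrix.of fun _ _ : Fin 1 => S) a b
  have h2 := inner_compress w (Matrix.of fun _ _ : Fin 1 => T) a b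
  rw [hx, hy, inner_matOp] at h1 h2
  have h3 : (Matrix.of fun _ _ : Fin 1 => S).map (compress w) =
      (Matrix.of fun _ _ : Fin 1 => T).map (compress w) :=
    Matrix.ext fun _ _ => h m w hw
  rw [h3] at h1
  simpa using h1.symm.trans h2

end HilbertSpace

/-! ### Scalar products and matrix pairings -/

theorem l2_opNorm_of_subsingleton (a : ℂ) :
    ‖(Matrix.of fun _ _ => a : Matrix (Fin 1) (Fin 1) ℂ)‖ = ‖a‖ := by
  have h : (Matrix.of fun _ _ => a : Matrix (Fin 1) (Fin 1) ℂ) = Matrix.diagonal fun _ => a :=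
    Matrix.ext fun i j => by simp [Subsingleton.elim i j]
  rw [h, Matrix.l2_opNorm_diagonal]
  simp

theorem norm_comp_injective_le {ι κ : Type*} [Fintype ι] [Fintype κ] (a : EuclideanSpace ℂ κ)
    {e : ι → κ} (he : Function.Injective e) :
    ‖(WithLp.toLp 2 fun k => a (e k) : EuclideanSpace ℂ ι)‖ ≤ ‖a‖ := by
  classical
  rw [EuclideanSpace.norm_eq, EuclideanSpace.norm_eq]
  refine Real.sqrt_le_sqrt ?_
  change ∑ k, ‖a (e k)‖ ^ 2 ≤ _
  rw [← Finset.sum_image (f := fun q => ‖a q‖ ^ 2) (g := e) he.injOn]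
  exact Finset.sum_le_sum_of_subset_of_nonneg (Finset.subset_univ _) fun _ _ _ => by positivity

theorem matNorm_matrix_le_sum {n m : ℕ} (x : Matrix (Fin n) (Fin n) (Matrix (Fin m) (Fin m) ℂ)) :
    matNorm n x ≤ ∑ i, ∑ j, ‖x i j‖ := by
  refine opNorm_le_of_norm_inner_le (Matrix.toEuclideanCLM (𝕜 := ℂ)
    (Matrix.comp (Fin n) (Fin n) (Fin m) (Fin m) ℂ x)) (by positivity) fun a b => ?_
  have h : inner ℂ a (Matrix.toEuclideanCLM (𝕜 := ℂ)
      (Matrix.comp (Fin n) (Fin n) (Fin m) (Fin m) ℂ x) b) =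
      ∑ i, ∑ j, inner ℂ (WithLp.toLp 2 fun k => a (i, k) : EuclideanSpace ℂ (Fin m))
        (Matrix.toEuclideanCLM (𝕜 := ℂ) (x i j) (WithLp.toLp 2 fun k => b (j, k))) := by
    simp only [inner_toEuclideanCLM_eq_sum, Fintype.sum_prod_type, Matrix.comp_apply]
    exact Finset.sum_congr rfl fun i _ => Finset.sum_comm
  rw [h, Finset.sum_mul, Finset.sum_mul]
  refine (norm_sum_le _ _).trans (Finset.sum_le_sum fun i _ => ?_)
  rw [Finset.sum_mul, Finset.sum_mul]
  refine (norm_sum_le _ _).trans (Finset.sum_le_sum fun j _ => ?_)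
  refine (norm_inner_apply_le _ _ _).trans ?_
  exact mul_le_mul (mul_le_mul_of_nonneg_left (norm_comp_injective_le a (Prod.mk_right_injective i))
    (norm_nonneg _)) (norm_comp_injective_le b (Prod.mk_right_injective j)) (norm_nonneg _)
    (mul_nonneg (norm_nonneg _) (norm_nonneg _))

section Pairing

variable {Y : Type u} [NormedAddCommGroup Y] [NormedSpace ℂ Y]

theorem matSandwich_scalar {n : ℕ} (x : Matrix (Fin n) (Fin n) Y) (r : ℝ) :
    matSandwich (Matrix.diagonal fun _ => (r : ℂ))ᴴ x (Matrix.diagonal fun _ => (r : ℂ)) =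
      ((r * r : ℝ) : ℂ) • x := by
  ext i j
  simp [matSandwich, Matrix.diagonal_apply, ite_smul, apply_ite, eq_comm]

theorem inner_matEval {m n : ℕ} (f : Matrix (Fin n) (Fin n) (WeakDual ℂ Y))
    (x : Matrix (Fin m) (Fin m) Y) (a b : EuclideanSpace ℂ (Fin m × Fin n)) :
    inner ℂ a (Matrix.toEuclideanCLM (𝕜 := ℂ) (matEval f x) b) =
      ∑ i, ∑ j, f i j (∑ k, ∑ l, (star (a (k, i)) * b (l, j)) • x k l) := by
  rw [inner_toEuclideanCLM_eq_sum]
  simp only [Fintype.sum_prod_type, map_sum, map_smul, matEval, Matrix.of_apply, smul_eq_mul]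
  rw [Finset.sum_comm]
  refine Finset.sum_congr rfl fun i _ => ?_
  simp only [fun k => Finset.sum_comm (s := (Finset.univ : Finset (Fin m)))
    (t := (Finset.univ : Finset (Fin n)))
    (f := fun l j => star (a (k, i)) * f i j (x k l) * b (l, j))]
  rw [Finset.sum_comm]
  refine Finset.sum_congr rfl fun j _ => Finset.sum_congr rfl fun k _ =>
    Finset.sum_congr rfl fun l _ => by ring

/-- Weak*-continuous functionals on a dual space are evaluations. -/
theorem exists_eval_of_continuous (g : WeakDual ℂ Y →ₗ[ℂ] ℂ) (hg : Continuous g) :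
    ∃ y : Y, ∀ f, g f = f y := by
  obtain ⟨y, hy⟩ := LinearMap.dualEmbedding_surjective (topDualPairing ℂ Y)
    (⟨g, hg⟩ : WeakDual ℂ Y →L[ℂ] ℂ)
  exact ⟨y, fun f => (DFunLike.congr_fun hy f).symm⟩

end Pairing

/-! ### Norm and cone estimates in a semi-matrix ordered operator space -/

section SMOS

variable {Y : Type u} [NormedAddCommGroup Y] [NormedSpace ℂ Y] [StarAddMonoid Y]
  [StarModule ℂ Y] [NormedStarGroup Y] [SMOS Y]

theorem matNorm_zero (n : ℕ) : matNorm n (0 : Matrix (Fin n) (Fin n) Y) = 0 := by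
  simpa using SMOS.matNorm_smul n (0 : ℂ) (0 : Matrix (Fin n) (Fin n) Y)

theorem matNorm_nonneg {n : ℕ} (x : Matrix (Fin n) (Fin n) Y) : 0 ≤ matNorm n x := by
  have h1 := SMOS.matNorm_add n x ((-1 : ℂ) • x)
  rw [SMOS.matNorm_smul] at h1
  simp only [neg_smul, one_smul, add_neg_cancel, matNorm_zero, norm_neg, norm_one] at h1
  linarith

/-- Ruan's axiom with a single summand. -/
theorem matNorm_sandwich_le {m n : ℕ} (x : Matrix (Fin m) (Fin m) Y)
    (α : Matrix (Fin n) (Fin m) ℂ) (β : Matrix (Fin m) (Fin n) ℂ) :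
    matNorm n (matSandwich α x β) ≤
      Real.sqrt ‖α * αᴴ‖ * Real.sqrt ‖βᴴ * β‖ * matNorm m x := by
  have h := SMOS.matNorm_sandwich_add m m n x (0 : Matrix (Fin m) (Fin m) Y) α β 0 0
  have h0 : matSandwich (0 : Matrix (Fin n) (Fin m) ℂ) (0 : Matrix (Fin m) (Fin m) Y) 0 = 0 := by
    ext; simp [matSandwich]
  simpa [h0, matNorm_zero, matNorm_nonneg] using h

/-- Ruan's axiom for the compression of `x` to `M_1(Y)` by two columns. -/
theorem norm_sum_smul_le_matNorm {m : ℕ} (x : Matrix (Fin m) (Fin m) Y)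
    (a b : EuclideanSpace ℂ (Fin m)) :
    ‖∑ k, ∑ l, (star (a k) * b l) • x k l‖ ≤ ‖a‖ * ‖b‖ * matNorm m x := by
  have hcol : ∀ c : EuclideanSpace ℂ (Fin m),
      Real.sqrt ‖(Matrix.of fun (_ : Fin 1) k => star (c k)) *
        (Matrix.of fun k (_ : Fin 1) => c k)‖ = ‖c‖ := fun c => by
    have h : (Matrix.of fun (_ : Fin 1) k => star (c k)) * (Matrix.of fun k (_ : Fin 1) => c k) =
        Matrix.of fun _ _ => ((∑ k, ‖c k‖ ^ 2 : ℝ) : ℂ) := by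
      ext i j
      simp [Matrix.mul_apply, Complex.conj_mul']
    rw [h, l2_opNorm_of_subsingleton, Complex.norm_real, Real.norm_eq_abs,
      abs_of_nonneg (by positivity), EuclideanSpace.norm_eq]
  have h := matNorm_sandwich_le x (Matrix.of fun (_ : Fin 1) k => star (a k))
    (Matrix.of fun k (_ : Fin 1) => b k)
  have ha : (Matrix.of fun (_ : Fin 1) k => star (a k))ᴴ = Matrix.of fun k (_ : Fin 1) => a k := by
    ext; simp
  have hb : (Matrix.of fun k (_ : Fin 1) => b k)ᴴ = Matrix.of fun (_ : Fin 1) k => star (b k) := by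
    ext; simp
  rw [ha, hb, hcol, hcol] at h
  rwa [← SMOS.matNorm_one]

theorem matNorm_sum_le {n : ℕ} {ι : Type*} (s : Finset ι) (x : ι → Matrix (Fin n) (Fin n) Y) :
    matNorm n (∑ i ∈ s, x i) ≤ ∑ i ∈ s, matNorm n (x i) := by
  classical
  induction s using Finset.induction_on with
  | empty => simp [matNorm_zero]
  | insert a s ha ih =>
    rw [Finset.sum_insert ha, Finset.sum_insert ha]
    exact (SMOS.matNorm_add n _ _).trans (by gcongr)

theorem matNorm_le_sum_norm {n : ℕ} (x : Matrix (Fin n) (Fin n) Y) :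
    matNorm n x ≤ ∑ i, ∑ j, ‖x i j‖ := by
  classical
  have hunit : ∀ i : Fin n, ‖(Matrix.of fun k (_ : Fin 1) => if k = i then (1 : ℂ) else 0) *
      (Matrix.of fun (_ : Fin 1) k => if k = i then (1 : ℂ) else 0)‖ ≤ 1 := fun i => by
    have h : (Matrix.of fun k (_ : Fin 1) => if k = i then (1 : ℂ) else 0) *
        (Matrix.of fun (_ : Fin 1) k => if k = i then (1 : ℂ) else 0) =
        Matrix.diagonal fun k => if k = i then (1 : ℂ) else 0 := by
      ext k l
      by_cases hk : k = i <;> by_cases hl : l = i <;> by_cases hkl : k = l <;>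
        simp_all [Matrix.mul_apply]
    rw [h, Matrix.l2_opNorm_diagonal]
    refine (pi_norm_le_iff_of_nonneg zero_le_one).2 fun k => ?_
    split_ifs <;> simp
  have hx : x = ∑ i, ∑ j, matSandwich
      (Matrix.of fun k (_ : Fin 1) => if k = i then (1 : ℂ) else 0)
      (Matrix.of fun _ _ => x i j)
      (Matrix.of fun (_ : Fin 1) k => if k = j then (1 : ℂ) else 0) := by
    ext k l
    simp [matSandwich, Matrix.sum_apply, ite_smul, apply_ite]
  conv_lhs => rw [hx]
  refine (matNorm_sum_le _ _).trans (Finset.sum_le_sum fun i _ =>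
    (matNorm_sum_le _ _).trans (Finset.sum_le_sum fun j _ => ?_))
  refine (matNorm_sandwich_le _ _ _).trans ?_
  rw [SMOS.matNorm_one]
  have ha : (Matrix.of fun k (_ : Fin 1) => if k = i then (1 : ℂ) else 0)ᴴ =
      Matrix.of fun (_ : Fin 1) k => if k = i then (1 : ℂ) else 0 := by
    ext; simp [apply_ite]
  have hb : (Matrix.of fun (_ : Fin 1) k => if k = j then (1 : ℂ) else 0)ᴴ =
      Matrix.of fun k (_ : Fin 1) => if k = j then (1 : ℂ) else 0 := by
    ext; simp [apply_ite]
  rw [ha, hb]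
  refine mul_le_of_le_one_left (norm_nonneg _) (mul_le_one₀ ?_ (Real.sqrt_nonneg _) ?_)
  · exact Real.sqrt_le_one.2 (hunit i)
  · exact Real.sqrt_le_one.2 (hunit j)

theorem sandwich_mem_matCone {m n : ℕ} {x : Matrix (Fin m) (Fin m) Y} (hx : x ∈ matCone m)
    (α : Matrix (Fin m) (Fin n) ℂ) : matSandwich αᴴ x α ∈ matCone n := by
  have h := SMOS.sandwich_add_mem_matCone m m n x 0 α 0 hx (SMOS.zero_mem_matCone m)
  have h0 : matSandwich (0 : Matrix (Fin m) (Fin n) ℂ)ᴴ (0 : Matrix (Fin m) (Fin m) Y) 0 = 0 := by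
    ext; simp [matSandwich]
  rwa [h0, add_zero] at h

theorem add_smul_mem_matCone {n : ℕ} {x y : Matrix (Fin n) (Fin n) Y} (hx : x ∈ matCone n)
    (hy : y ∈ matCone n) {s t : ℝ} (hs : 0 ≤ s) (ht : 0 ≤ t) :
    (s : ℂ) • x + (t : ℂ) • y ∈ matCone n := by
  have h := SMOS.sandwich_add_mem_matCone n n n x y (Matrix.diagonal fun _ => (Real.sqrt s : ℂ))
    (Matrix.diagonal fun _ => (Real.sqrt t : ℂ)) hx hy
  rwa [matSandwich_scalar, matSandwich_scalar, Real.mul_self_sqrt hs, Real.mul_self_sqrt ht] at h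

/-! ### The dual matrix norm and weak*-continuous functionals -/

/-- Bounded functionals are completely bounded. -/
theorem norm_matEval_le {m n : ℕ} (f : Matrix (Fin n) (Fin n) (WeakDual ℂ Y))
    (x : Matrix (Fin m) (Fin m) Y) :
    ‖matEval f x‖ ≤ (∑ i, ∑ j, ‖WeakDual.toStrongDual (f i j)‖) * matNorm m x := by
  refine opNorm_le_of_norm_inner_le (Matrix.toEuclideanCLM (𝕜 := ℂ) (matEval f x))
    (mul_nonneg (by positivity) (matNorm_nonneg x)) fun a b => ?_
  rw [inner_matEval, Finset.sum_mul, Finset.sum_mul, Finset.sum_mul]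
  refine (norm_sum_le _ _).trans (Finset.sum_le_sum fun i _ => ?_)
  rw [Finset.sum_mul, Finset.sum_mul, Finset.sum_mul]
  refine (norm_sum_le _ _).trans (Finset.sum_le_sum fun j _ => ?_)
  refine ((WeakDual.toStrongDual (f i j)).le_opNorm _).trans ?_
  rw [mul_assoc, mul_assoc]
  refine mul_le_mul_of_nonneg_left ?_ (norm_nonneg _)
  refine (norm_sum_smul_le_matNorm x (WithLp.toLp 2 fun k => a (k, i))
    (WithLp.toLp 2 fun k => b (k, j))).trans ?_
  rw [mul_comm (matNorm m x)]
  exact mul_le_mul_of_nonneg_right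
    (mul_le_mul (norm_comp_injective_le a (Prod.mk_left_injective i))
      (norm_comp_injective_le b (Prod.mk_left_injective j)) (norm_nonneg _) (norm_nonneg _))
    (matNorm_nonneg x)

theorem norm_matEval_le_matNorm {m n : ℕ} (f : Matrix (Fin n) (Fin n) (WeakDual ℂ Y))
    {x : Matrix (Fin m) (Fin m) Y} (hx : matNorm m x ≤ 1) : ‖matEval f x‖ ≤ matNorm n f := by
  refine le_csSup ⟨∑ i, ∑ j, ‖WeakDual.toStrongDual (f i j)‖, ?_⟩ ⟨m, x, hx, rfl⟩
  rintro _ ⟨k, y, hy, rfl⟩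
  exact (norm_matEval_le f y).trans (mul_le_of_le_one_right (by positivity) hy)

theorem matNorm_dual_nonneg {n : ℕ} (f : Matrix (Fin n) (Fin n) (WeakDual ℂ Y)) :
    0 ≤ matNorm n f := by
  refine Real.sSup_nonneg ?_
  rintro _ ⟨m, x, -, rfl⟩
  exact norm_nonneg _

theorem matNorm_one_dual_le (f : WeakDual ℂ Y) :
    matNorm 1 (Matrix.of fun _ _ : Fin 1 => f) ≤ ‖WeakDual.toStrongDual f‖ := by
  refine Real.sSup_le ?_ (norm_nonneg _)
  rintro _ ⟨m, x, hx, rfl⟩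
  refine (norm_matEval_le _ x).trans ?_
  simpa using mul_le_of_le_one_right (norm_nonneg (WeakDual.toStrongDual f)) hx

/-- An absolutely summable combination of matrix coefficients of weak*-continuous complete
contractions is weak*-continuous: it is evaluation at the norm convergent sum of the elements
representing its terms. -/
theorem exists_eval_eq_tsum [CompleteSpace Y] {ι : Type*} {n : ι → ℕ}
    {ψ : ∀ i, WeakDual ℂ Y →ₗ[ℂ] Matrix (Fin (n i)) (Fin (n i)) ℂ} (hψ : ∀ i, IsCCPw (ψ i))
    {ω : ∀ i, StrongDual ℂ (Matrix (Fin (n i)) (Fin (n i)) ℂ)} (hω : Summable fun i => ‖ω i‖) :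
    ∃ y : Y, ∀ f, ∑' i, ω i (ψ i f) = f y := by
  choose y hy using fun i => exists_eval_of_continuous ((ω i).toLinearMap ∘ₗ ψ i)
    ((ω i).continuous.comp (hψ i).continuous)
  have hle : ∀ i, ‖y i‖ ≤ ‖ω i‖ := fun i => by
    refine NormedSpace.norm_le_dual_bound ℂ _ (norm_nonneg _) fun f => ?_
    have h1 : f (y i) = ω i (ψ i (StrongDual.toWeakDual f)) := (hy i (StrongDual.toWeakDual f)).symm
    rw [h1]
    refine ((ω i).le_opNorm _).trans (mul_le_mul_of_nonneg_left ?_ (norm_nonneg _))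
    refine (norm_le_matNorm_one _).trans ?_
    exact ((hψ i).matNorm_map_le 1 (Matrix.of fun _ _ => StrongDual.toWeakDual f)).trans
      (matNorm_one_dual_le _)
  have hs : Summable y := Summable.of_norm_bounded hω hle
  refine ⟨∑' i, y i, fun f => ?_⟩
  have h := (WeakDual.toStrongDual f).map_tsum hs
  exact (tsum_congr fun i => hy i f).trans h.symm

end SMOS

/-! ### The universal dual and its predual -/

section UniversalDual

variable {Y : Type u} [NormedAddCommGroup Y] [NormedSpace ℂ Y] [StarAddMonoid Y]
  [StarModule ℂ Y] [NormedStarGroup Y] [SMOS Y]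

theorem norm_nPairing_le (x : NSpace Y) (ω : NPredual Y) : ‖nPairing Y x ω‖ ≤ ‖x‖ * ‖ω‖ := by
  have h1 : Summable fun i => ‖ω i‖ := by
    simpa using (lp.memℓp ω).summable (by simp)
  have h2 : ‖ω‖ = ∑' i, ‖ω i‖ := by
    simpa using lp.norm_eq_tsum_rpow (p := 1) (by simp) ω
  rw [h2, ← tsum_mul_left]
  refine tsum_of_norm_bounded (h1.mul_left ‖x‖).hasSum fun i => ?_
  refine ((ω i).le_opNorm (x i)).trans ?_
  rw [mul_comm]
  exact mul_le_mul_of_nonneg_right (lp.norm_apply_le_norm (by simp) x i) (norm_nonneg _)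

/-- The functional on the predual of `N(Y^*)` given by an element of `N(Y^*)`. -/
noncomputable def nPairingCLM (x : NAlg Y) : NPredual Y →L[ℂ] ℂ :=
  (nPairing Y x).mkContinuousOfExistsBound ⟨_, norm_nPairing_le x⟩

theorem nPairing_single [DecidableEq (CCPwIndex Y)] (x : NAlg Y) (i : CCPwIndex Y)
    (ℓ : StrongDual ℂ (Matrix (Fin i.1) (Fin i.1) ℂ)) :
    nPairing Y x (lp.single 1 i ℓ) = ℓ (NAlg.coord Y i x) := by
  change ∑' j, (lp.single 1 i ℓ : NPredual Y) j (NAlg.coord Y j x) = _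
  rw [tsum_eq_single i fun j hj => by rw [lp.single_apply_ne _ _ _ hj]; rfl, lp.single_apply_self]

theorem continuous_nPairing (ω : NPredual Y) :
    Continuous fun x : UniversalDual Y => nPairing Y x.1 ω :=
  (WeakBilin.eval_continuous (nPairing Y) ω).comp continuous_subtype_val

theorem continuous_coord (i : CCPwIndex Y) :
    Continuous fun x : UniversalDual Y => NAlg.coord Y i x.1 := by
  classical
  refine continuous_matrix fun k l => ?_
  refine (continuous_nPairing (lp.single 1 i
    (LinearMap.toContinuousLinearMap (Matrix.entryLinearMap ℂ ℂ k l)))).congr fun x => ?_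
  rw [nPairing_single]
  rfl

theorem denseRange_iotaMap : DenseRange (iotaMap Y) := by
  intro x
  refine closure_subtype.2 (closure_mono ?_ x.2)
  rintro _ ⟨f, rfl⟩
  exact ⟨iotaMap Y f, ⟨f, rfl⟩, rfl⟩

/-- Weak*-continuity of `ι`; this uses that `Y` is complete. -/
theorem continuous_iotaMap [CompleteSpace Y] : Continuous (iotaMap Y) := by
  refine Continuous.subtype_mk (WeakBilin.continuous_of_continuous_eval _ fun ω => ?_) _
  have h1 : Summable fun i => ‖ω i‖ := by
    simpa using (lp.memℓp ω).summable (by simp)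
  obtain ⟨y, hy⟩ := exists_eval_eq_tsum (fun i : CCPwIndex Y => i.2.2) h1
  exact (WeakDual.eval_continuous y).congr fun f => (hy f).symm

theorem bddAbove_matNorm_coord {n : ℕ} (x : Matrix (Fin n) (Fin n) (NAlg Y)) :
    BddAbove (Set.range fun i => matNorm n (x.map (NAlg.coord Y i))) := by
  let x' : Matrix (Fin n) (Fin n) (NSpace Y) := x
  refine ⟨∑ k, ∑ l, ‖x' k l‖, ?_⟩
  rintro _ ⟨i, rfl⟩
  refine (matNorm_matrix_le_sum _).trans ?_
  exact Finset.sum_le_sum fun k _ => Finset.sum_le_sum fun l _ =>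
    lp.norm_apply_le_norm (by simp) (x' k l) i

theorem matNorm_coord_le {n : ℕ} (x : Matrix (Fin n) (Fin n) (UniversalDual Y))
    (i : CCPwIndex Y) :
    matNorm n (x.map fun y => NAlg.coord Y i y.1) ≤ matNorm n x :=
  le_ciSup (bddAbove_matNorm_coord (x.map (UniversalDual Y).subtype)) i

/-- By density of `Y^*`, an element of the predual of `N(Y^*)` is determined on the universal dual
by its restriction to `Y^*`. -/
theorem nPairing_congr {ω ω' : NPredual Y}
    (h : ∀ f, nPairing Y (muMap Y f) ω = nPairing Y (muMap Y f) ω') (x : UniversalDual Y) :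
    nPairing Y x.1 ω = nPairing Y x.1 ω' :=
  congrFun (denseRange_iotaMap.equalizer (continuous_nPairing ω) (continuous_nPairing ω')
    (funext h)) x

/-- If the matrix coefficients of `φ : Y^* → Z^*` come from the predual of `N(Y^*)`, then the open
mapping theorem selects norm bounded representatives. -/
theorem exists_bounded_predual {Z : Type v} [NormedAddCommGroup Z]
    [NormedSpace ℂ Z] [CompleteSpace Z] (φ : WeakDual ℂ Y →ₗ[ℂ] WeakDual ℂ Z)
    (h : ∀ z, ∃ ω : NPredual Y, ∀ f, φ f z = nPairing Y (muMap Y f) ω) :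
    ∃ (C : ℝ) (ω : Z → NPredual Y), (∀ z f, φ f z = nPairing Y (muMap Y f) (ω z)) ∧
      ∀ z, ‖ω z‖ ≤ C * ‖z‖ := by
  let ev : WeakDual ℂ Y → Z × NPredual Y →L[ℂ] ℂ := fun f =>
    (WeakDual.toStrongDual (φ f)).comp (ContinuousLinearMap.fst ℂ Z (NPredual Y)) -
      (nPairingCLM (muMap Y f)).comp (ContinuousLinearMap.snd ℂ Z (NPredual Y))
  let G : Submodule ℂ (Z × NPredual Y) := ⨅ f, LinearMap.ker (ev f).toLinearMap
  have hG : ∀ p : Z × NPredual Y, p ∈ G ↔ ∀ f, φ f p.1 = nPairing Y (muMap Y f) p.2 := fun p => by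
    simp only [G, Submodule.mem_iInf]
    exact forall_congr' fun f => sub_eq_zero
  have hclosed : IsClosed (G : Set (Z × NPredual Y)) := by
    simp only [G, Submodule.coe_iInf]
    exact isClosed_iInter fun f => (ev f).isClosed_ker
  have : CompleteSpace G := hclosed.completeSpace_coe
  obtain ⟨C, hC, hsel⟩ := ContinuousLinearMap.exists_preimage_norm_le
    ((ContinuousLinearMap.fst ℂ Z (NPredual Y)).comp G.subtypeL) fun z => by
      obtain ⟨ω, hω⟩ := h z
      exact ⟨⟨(z, ω), (hG _).2 hω⟩, rfl⟩
  choose p hp1 hp2 using hsel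
  have hp1' : ∀ z, (p z).1.1 = z := hp1
  refine ⟨C, fun z => (p z).1.2, fun z f => ?_, fun z => (norm_snd_le (p z).1).trans (hp2 z)⟩
  have h2 := (hG _).1 (p z).2 f
  rwa [hp1'] at h2

/-- The weak*-continuous extension to the universal dual of a linear map `φ : Y^* → Z^*` whose
matrix coefficients come from the predual of `N(Y^*)`. -/
theorem exists_continuous_extension {Z : Type v} [NormedAddCommGroup Z]
    [NormedSpace ℂ Z] [CompleteSpace Z] (φ : WeakDual ℂ Y →ₗ[ℂ] WeakDual ℂ Z)
    (h : ∀ z, ∃ ω : NPredual Y, ∀ f, φ f z = nPairing Y (muMap Y f) ω) :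
    ∃ φb : UniversalDual Y →ₗ[ℂ] WeakDual ℂ Z, Continuous φb ∧ φb ∘ₗ iotaMap Y = φ := by
  obtain ⟨C, ω, hω, hC⟩ := exists_bounded_predual φ h
  have hadd : ∀ (x : UniversalDual Y) z z',
      nPairing Y x.1 (ω (z + z')) = nPairing Y x.1 (ω z) + nPairing Y x.1 (ω z') :=
    fun x z z' => by
      rw [← map_add]
      exact nPairing_congr (fun f => by rw [map_add, ← hω, ← hω, ← hω, map_add]) x
  have hsmul : ∀ (x : UniversalDual Y) (c : ℂ) z,
      nPairing Y x.1 (ω (c • z)) = c • nPairing Y x.1 (ω z) := fun x c z => by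
    rw [← map_smul]
    exact nPairing_congr (fun f => by rw [map_smul, ← hω, ← hω, map_smul]) x
  have hB : ∀ x : UniversalDual Y, ∃ K : ℝ, ∀ z, ‖nPairing Y x.1 (ω z)‖ ≤ K * ‖z‖ := fun x => by
    refine ⟨‖nPairingCLM x.1‖ * C, fun z => ((nPairingCLM x.1).le_opNorm (ω z)).trans ?_⟩
    rw [mul_assoc]
    exact mul_le_mul_of_nonneg_left (hC z) (norm_nonneg _)
  let B : UniversalDual Y → StrongDual ℂ Z := fun x =>
    LinearMap.mkContinuousOfExistsBound
      { toFun := fun z => nPairing Y x.1 (ω z), map_add' := hadd x, map_smul' := hsmul x } (hB x)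
  let φb : UniversalDual Y →ₗ[ℂ] WeakDual ℂ Z :=
    { toFun := fun x => StrongDual.toWeakDual (B x)
      map_add' := fun x y => DFunLike.ext _ _ fun z =>
        LinearMap.congr_fun (map_add (nPairing Y) x.1 y.1) (ω z)
      map_smul' := fun c x => DFunLike.ext _ _ fun z =>
        LinearMap.congr_fun (map_smul (nPairing Y) c x.1) (ω z) }
  refine ⟨φb, WeakDual.continuous_of_continuous_eval fun z => continuous_nPairing (ω z),
    LinearMap.ext fun f => DFunLike.ext _ _ fun z => (hω z f).symm⟩

theorem ext_of_comp_iotaMap {Z : Type*} [AddCommGroup Z] [Module ℂ Z] [TopologicalSpace Z]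
    [T2Space Z] {χ χ' : UniversalDual Y →ₗ[ℂ] Z} (hχ : Continuous χ) (hχ' : Continuous χ')
    (h : χ ∘ₗ iotaMap Y = χ' ∘ₗ iotaMap Y) : χ = χ' :=
  DFunLike.coe_injective (denseRange_iotaMap.equalizer hχ hχ' (congrArg DFunLike.coe h))

end UniversalDual

/-! ### Weak*-continuous maps into operator algebras -/

theorem summable_norm_mul_norm {H : Type*} [NormedAddCommGroup H]
    (p : lp (fun _ : ℕ => H) 2 × lp (fun _ : ℕ => H) 2) :
    Summable fun i => ‖p.2 i‖ * ‖p.1 i‖ := by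
  have h : ∀ q : lp (fun _ : ℕ => H) 2, Summable fun i => ‖q i‖ ^ 2 := fun q => by
    simpa using (lp.memℓp q).summable (by simp)
  refine Summable.of_nonneg_of_le (fun i => by positivity) (fun i => ?_) ((h p.2).add (h p.1))
  nlinarith [sq_nonneg (‖p.2 i‖ - ‖p.1 i‖), sq_nonneg ‖p.2 i‖, sq_nonneg ‖p.1 i‖]

section Ultraweak

variable {H : Type w} [NormedAddCommGroup H] [InnerProductSpace ℂ H]

theorem summable_inner_apply (p : lp (fun _ : ℕ => H) 2 × lp (fun _ : ℕ => H) 2) (T : H →L[ℂ] H) :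
    Summable fun i => inner ℂ (p.2 i) (T (p.1 i)) := by
  refine Summable.of_norm_bounded ((summable_norm_mul_norm p).mul_left ‖T‖) fun i => ?_
  rw [← mul_assoc]
  exact norm_inner_apply_le T _ _

/-- The ultraweakly continuous functional `T ↦ ∑ᵢ ⟪ηᵢ, T ξᵢ⟫`. -/
noncomputable def ultraweakFunctional (p : lp (fun _ : ℕ => H) 2 × lp (fun _ : ℕ => H) 2) :
    (H →L[ℂ] H) →ₗ[ℂ] ℂ where
  toFun T := ∑' i, inner ℂ (p.2 i) (T (p.1 i))
  map_add' S T := by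
    rw [← (summable_inner_apply p S).tsum_add (summable_inner_apply p T)]
    simp only [add_apply, inner_add_right]
  map_smul' c T := by
    rw [RingHom.id_apply, smul_eq_mul, ← tsum_mul_left]
    simp only [smul_apply, inner_smul_right]

theorem ultraweakTopology_eq_iInf : ultraweakTopology H =
    ⨅ p, TopologicalSpace.induced (ultraweakFunctional (H := H) p) inferInstance := by
  rw [ultraweakTopology, Pi.topologicalSpace, induced_iInf]
  simp only [induced_compose]
  rfl

theorem continuous_compress {m : ℕ} (w : Fin m → H) :
    @Continuous (H →L[ℂ] H) _ (ultraweakTopology H) _ (compress w) := by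
  refine @continuous_matrix _ _ _ _ _ (ultraweakTopology H) _ fun k l => ?_
  let p : lp (fun _ : ℕ => H) 2 × lp (fun _ : ℕ => H) 2 :=
    (lp.single 2 0 (w l), lp.single 2 0 (w k))
  have h : @Continuous _ _ (ultraweakTopology H) _ (ultraweakFunctional p) :=
    continuous_iff_le_induced.2 (ultraweakTopology_eq_iInf.trans_le (iInf_le _ p))
  refine @Continuous.congr _ _ (ultraweakTopology H) _ _ _ h fun T => ?_
  change ∑' i, inner ℂ ((lp.single 2 0 (w k) : lp (fun _ : ℕ => H) 2) i)
    (T ((lp.single 2 0 (w l) : lp (fun _ : ℕ => H) 2) i)) = inner ℂ (w k) (T (w l))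
  rw [tsum_eq_single 0 fun j hj => by rw [lp.single_apply_ne _ _ _ hj, inner_zero_left],
    lp.single_apply_self, lp.single_apply_self]

/-- A continuous functional for the topology pulled back from the ultraweak topology is a finite
linear combination of functionals `v ↦ ∑ᵢ ⟪ηᵢ, Ψ(v) ξᵢ⟫`. -/
theorem mem_span_ultraweakFunctional {V : Type*} [AddCommGroup V] [Module ℂ V]
    [t : TopologicalSpace V] {Ψ : V →ₗ[ℂ] (H →L[ℂ] H)}
    (hΨ : @Topology.IsInducing _ _ t (ultraweakTopology H) Ψ)
    (g : V →ₗ[ℂ] ℂ) (hg : Continuous g) :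
    g ∈ Submodule.span ℂ (Set.range fun p => ultraweakFunctional (H := H) p ∘ₗ Ψ) := by
  rw [LinearMap.mem_span_iff_continuous]
  have h : t = ⨅ p, TopologicalSpace.induced (ultraweakFunctional (H := H) p ∘ₗ Ψ)
      inferInstance := by
    rw [@Topology.IsInducing.eq_induced _ _ t (ultraweakTopology H) _ hΨ,
      ultraweakTopology_eq_iInf, induced_iInf]
    simp only [induced_compose]
    rfl
  rwa [← h]

variable {Y : Type u} [NormedAddCommGroup Y] [NormedSpace ℂ Y] [StarAddMonoid Y]
  [StarModule ℂ Y] [NormedStarGroup Y] [SMOS Y]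

/-- The coefficient functionals `⟪η, Φ(·) ξ⟫` factor through the compression of `Φ` to the span of
`η` and `ξ`, which is one of the coordinates of `N(Y^*)`. -/
theorem exists_coord_functional {Φ : WeakDual ℂ Y →ₗ[ℂ] (H →L[ℂ] H)}
    (hΦ : ∀ (m : ℕ) (w : Fin m → H), Orthonormal ℂ w → IsCCPw (compress w ∘ₗ Φ)) (η ξ : H) :
    ∃ ω : NPredual Y, ‖ω‖ ≤ ‖η‖ * ‖ξ‖ ∧
      ∀ f, inner ℂ η (Φ f ξ) = nPairing Y (muMap Y f) ω := by
  classical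
  obtain ⟨m, w, a, b, hw, ha, hb⟩ := exists_amplify_eq
    (WithLp.toLp 2 fun _ : Fin 1 => η) (WithLp.toLp 2 fun _ : Fin 1 => ξ)
  have hna : ‖a‖ = ‖η‖ := by
    rw [← norm_amplify hw a, ha, PiLp.norm_eq_of_L2]; simp
  have hnb : ‖b‖ = ‖ξ‖ := by
    rw [← norm_amplify hw b, hb, PiLp.norm_eq_of_L2]; simp
  let a' : EuclideanSpace ℂ (Fin m) := WithLp.toLp 2 fun k => a (0, k)
  let b' : EuclideanSpace ℂ (Fin m) := WithLp.toLp 2 fun k => b (0, k)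
  have ha' : ‖a'‖ ≤ ‖η‖ := hna ▸ norm_comp_injective_le a (Prod.mk_right_injective 0)
  have hb' : ‖b'‖ ≤ ‖ξ‖ := hnb ▸ norm_comp_injective_le b (Prod.mk_right_injective 0)
  let ℓ₀ : Matrix (Fin m) (Fin m) ℂ →ₗ[ℂ] ℂ :=
    { toFun := fun A => inner ℂ a' (Matrix.toEuclideanCLM (𝕜 := ℂ) A b')
      map_add' := fun A B => by rw [map_add, add_apply, inner_add_right]
      map_smul' := fun c A => by
        rw [map_smul, smul_apply, inner_smul_right]; rfl }
  have hℓ₀ : ∀ A, ‖ℓ₀ A‖ ≤ ‖η‖ * ‖ξ‖ * ‖A‖ := fun A => by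
    refine (norm_inner_apply_le _ _ _).trans ?_
    change ‖A‖ * ‖a'‖ * ‖b'‖ ≤ _
    calc ‖A‖ * ‖a'‖ * ‖b'‖ ≤ ‖A‖ * ‖η‖ * ‖ξ‖ := by gcongr
      _ = ‖η‖ * ‖ξ‖ * ‖A‖ := by ring
  let i : CCPwIndex Y := ⟨m, compress w ∘ₗ Φ, hΦ m w hw⟩
  refine ⟨lp.single 1 i (ℓ₀.mkContinuous _ hℓ₀), ?_, fun f => ?_⟩
  · rw [lp.norm_single (by simp)]
    exact LinearMap.mkContinuous_norm_le _ (by positivity) _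
  · rw [nPairing_single]
    have h := inner_compress w (Matrix.of fun _ _ : Fin 1 => Φ f) a b
    rw [ha, hb, inner_matOp, inner_toEuclideanCLM_eq_sum] at h
    refine Eq.trans ?_ (inner_toEuclideanCLM_eq_sum (compress w (Φ f)) a' b').symm
    simpa [Fintype.sum_prod_type, a', b'] using h.symm

/-- The functionals `f ↦ ∑ᵢ ⟪ηᵢ, Φ(f) ξᵢ⟫` belong to the predual of `N(Y^*)`. -/
theorem exists_predual_ultraweakFunctional {Φ : WeakDual ℂ Y →ₗ[ℂ] (H →L[ℂ] H)}
    (hΦ : ∀ (m : ℕ) (w : Fin m → H), Orthonormal ℂ w → IsCCPw (compress w ∘ₗ Φ))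
    (p : lp (fun _ : ℕ => H) 2 × lp (fun _ : ℕ => H) 2) :
    ∃ ω : NPredual Y, ∀ f, ultraweakFunctional p (Φ f) = nPairing Y (muMap Y f) ω := by
  choose ω hω1 hω2 using fun j => exists_coord_functional hΦ (p.2 j) (p.1 j)
  have hs : Summable ω := Summable.of_norm_bounded (summable_norm_mul_norm p) hω1
  refine ⟨∑' j, ω j, fun f => ?_⟩
  exact (tsum_congr fun j => hω2 j f).trans ((nPairingCLM (muMap Y f)).map_tsum hs).symm

end Ultraweak

/-! ### Complete positivity through compressions -/

section Extension

variable {H : Type w} [NormedAddCommGroup H] [InnerProductSpace ℂ H] [CompleteSpace H]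
variable {X : Type*} [AddCommGroup X] [Module ℂ X] [Star X] [MatrixOrderedData X]
variable {V : Type*} [AddCommGroup V] [Module ℂ V] [Star V] [MatrixOrderedData V]

theorem IsCCP.comp {W : Type*} [AddCommGroup W] [Module ℂ W] [Star W] [MatrixOrderedData W]
    {χ : V →ₗ[ℂ] W} {φ : X →ₗ[ℂ] V} (hχ : IsCCP χ) (hφ : IsCCP φ) : IsCCP (χ ∘ₗ φ) where
  map_star x := by rw [LinearMap.comp_apply, hφ.map_star, hχ.map_star]; rfl
  map_matCone n x hx := hχ.map_matCone n _ (hφ.map_matCone n x hx)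
  matNorm_map_le n x := (hχ.matNorm_map_le n _).trans (hφ.matNorm_map_le n x)

theorem isCCP_of_isCompleteOrderMono {Ψ : V →ₗ[ℂ] X} (h1 : IsCompleteOrderMono Ψ)
    (h2 : IsCompleteIsometry Ψ) (h3 : ∀ n, ∀ x ∈ (matCone n : Set (Matrix (Fin n) (Fin n) V)),
      xᴴ = x) : IsCCP Ψ where
  map_star := h1.map_star
  map_matCone n x hx := (h1.mem_matCone_iff n x (h3 n x hx)).2 hx
  matNorm_map_le n x := (h2 n x).le

/-- A map into an operator system is a completely positive complete contraction as soon as its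
compressions are. -/
theorem isCCP_of_compress {Ψ : V →ₗ[ℂ] (H →L[ℂ] H)} (h1 : IsCompleteOrderMono Ψ)
    (h2 : IsCompleteIsometry Ψ) {φ : X →ₗ[ℂ] V}
    (hX : ∀ n, ∀ x ∈ (matCone n : Set (Matrix (Fin n) (Fin n) X)), xᴴ = x)
    (hnorm : ∀ n (x : Matrix (Fin n) (Fin n) X), 0 ≤ matNorm n x)
    (h : ∀ (m : ℕ) (w : Fin m → H), Orthonormal ℂ w → IsCCP (compress w ∘ₗ Ψ ∘ₗ φ)) :
    IsCCP φ := by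
  have hstar : ∀ x, φ (star x) = star (φ x) := fun x => by
    refine h1.injective (ext_compress fun m w hw => ?_)
    rw [h1.map_star, (isCCP_compress hw).map_star]
    exact (h m w hw).map_star x
  refine ⟨hstar, fun n x hx => ?_, fun n x => ?_⟩
  · refine (h1.mem_matCone_iff n _ ?_).1 (mem_matCone_of_compress _ fun m w hw =>
      (h m w hw).map_matCone n x hx)
    ext i j
    rw [Matrix.conjTranspose_apply, Matrix.map_apply, ← hstar, ← Matrix.conjTranspose_apply,
      hX n x hx, Matrix.map_apply]
  · rw [← h2]
    exact matNorm_le_of_compress _ (hnorm n x) fun m w hw => (h m w hw).matNorm_map_le n x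

end Extension

/-! ### The regularization and the coordinates of the universal dual -/

section Regularization

variable {X : Type*} [AddCommGroup X] [Module ℂ X] [StarAddMonoid X] [MatrixOrderedData X]

theorem toRegularization_surjective : Function.Surjective (toRegularization X) :=
  (regKernel X).mkQ_surjective

theorem regLift_toRegularization {W : Type*} [AddCommGroup W] [Module ℂ W] (ψ : X →ₗ[ℂ] W)
    (hψ : regKernel X ≤ LinearMap.ker ψ) : regLift ψ hψ ∘ₗ toRegularization X = ψ :=
  (regKernel X).liftQ_mkQ ψ hψ

theorem exists_map_toRegularization {n : ℕ} (x : Matrix (Fin n) (Fin n) (Regularization X)) :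
    ∃ y : Matrix (Fin n) (Fin n) X, y.map (toRegularization X) = x := by
  choose y hy using fun i j => toRegularization_surjective (x i j)
  exact ⟨Matrix.of y, Matrix.ext hy⟩

/-- Completely positive complete contractions into matrix algebras induce completely positive
complete contractions on the regularization. -/
theorem isCCP_regLift {m : ℕ} {ψ : X →ₗ[ℂ] Matrix (Fin m) (Fin m) ℂ} (hψ : IsCCP ψ) :
    IsCCP (regLift ψ (regKernel_le hψ)) where
  map_star x := by
    obtain ⟨y, rfl⟩ := toRegularization_surjective x
    exact hψ.map_star y
  map_matCone n := by
    rintro _ ⟨y, hy, rfl⟩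
    exact hψ.map_matCone n y hy
  matNorm_map_le n x := by
    obtain ⟨y, rfl⟩ := exists_map_toRegularization x
    refine le_csSup ⟨matNorm n y, ?_⟩ ⟨m, ψ, hψ, rfl⟩
    rintro _ ⟨k, χ, hχ, rfl⟩
    exact hχ.matNorm_map_le n y

theorem conjTranspose_eq_of_mem_matCone_regularization
    (hX : ∀ n, ∀ x ∈ (matCone n : Set (Matrix (Fin n) (Fin n) X)), xᴴ = x) (n : ℕ) :
    ∀ x ∈ (matCone n : Set (Matrix (Fin n) (Fin n) (Regularization X))), xᴴ = x := by
  rintro _ ⟨y, hy, rfl⟩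
  ext i j
  change star (toRegularization X (y j i)) = toRegularization X (y i j)
  rw [← toRegularization_star]
  exact congrArg _ (congrFun (congrFun (hX n y hy) i) j)

theorem matNorm_regularization_nonneg {n : ℕ} (x : Matrix (Fin n) (Fin n) (Regularization X)) :
    0 ≤ matNorm n x := by
  refine Real.sSup_nonneg ?_
  rintro _ ⟨m, ψ, hψ, rfl⟩
  exact norm_nonneg _

end Regularization

section Coordinates

variable {Y : Type u} [NormedAddCommGroup Y] [NormedSpace ℂ Y] [StarAddMonoid Y]
  [StarModule ℂ Y] [NormedStarGroup Y] [SMOS Y]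

theorem isCCP_coord (i : CCPwIndex Y) : IsCCP (NAlg.coord Y i ∘ₗ (UniversalDual Y).subtype) where
  map_star x := NAlg.coord_star Y i x.1
  map_matCone _ _ hx := hx i
  matNorm_map_le _ x := matNorm_coord_le x i

theorem matNorm_universalDual_nonneg {n : ℕ} (x : Matrix (Fin n) (Fin n) (UniversalDual Y)) :
    0 ≤ matNorm n x :=
  Real.iSup_nonneg fun _ => norm_nonneg _

theorem conjTranspose_eq_of_mem_matCone_universalDual (n : ℕ) :
    ∀ x ∈ (matCone n : Set (Matrix (Fin n) (Fin n) (UniversalDual Y))), xᴴ = x := by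
  intro x hx
  refine Matrix.ext fun k l => Subtype.ext (NAlg.ext_coord fun i => Matrix.ext fun a b => ?_)
  have h : (Matrix.comp (Fin n) (Fin n) (Fin i.1) (Fin i.1) ℂ
    ((x.map (UniversalDual Y).subtype).map (NAlg.coord Y i))).PosSemidef := hx i
  exact congrFun (congrFun h.isHermitian (k, a)) (l, b)

theorem isCCP_iotaMap : IsCCP (iotaMap Y) where
  map_star f := Subtype.ext (muMap_star Y f)
  map_matCone n f hf i := i.2.2.map_matCone n f hf
  matNorm_map_le n f := Real.iSup_le (fun i => i.2.2.matNorm_map_le n f) (matNorm_dual_nonneg f)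

theorem image_iotaMap_subset_matCone (n : ℕ) :
    (fun f : Matrix (Fin n) (Fin n) (WeakDual ℂ Y) => f.map (iotaMap Y)) '' matCone n ⊆
      matCone n :=
  Set.image_subset_iff.2 fun f hf => isCCP_iotaMap.map_matCone n f hf

end Coordinates

/-! ### The extension to the universal dual -/

section DualOperatorSystem

variable {H : Type w} [NormedAddCommGroup H] [InnerProductSpace ℂ H] [CompleteSpace H]
variable {Y : Type u} [NormedAddCommGroup Y] [NormedSpace ℂ Y] [StarAddMonoid Y]
  [StarModule ℂ Y] [NormedStarGroup Y] [SMOS Y]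
variable {Z : Type v} [NormedAddCommGroup Z] [NormedSpace ℂ Z] [StarAddMonoid Z]
  [StarModule ℂ Z] [NormedStarGroup Z] [SMOS Z]
  {Ψ : WeakDual ℂ Z →ₗ[ℂ] (H →L[ℂ] H)} {φ : WeakDual ℂ Y →ₗ[ℂ] WeakDual ℂ Z}

theorem isCCPw_compress_comp (h1 : IsCompleteOrderMono Ψ) (h2 : IsCompleteIsometry Ψ)
    (h3 : @Continuous _ _ _ (ultraweakTopology H) Ψ) (hφ : IsCCPw φ) {m : ℕ} {w : Fin m → H}
    (hw : Orthonormal ℂ w) : IsCCPw (compress w ∘ₗ Ψ ∘ₗ φ) where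
  toIsCCP := (isCCP_compress hw).comp
    ((isCCP_of_isCompleteOrderMono h1 h2 fun _ _ hx => hx.1).comp hφ.toIsCCP)
  continuous := (@Continuous.comp _ _ _ _ (ultraweakTopology H) _ _ _
    (continuous_compress w) h3).comp hφ.continuous

theorem regKernel_le_ker_of_isCCP (h1 : IsCompleteOrderMono Ψ) (h2 : IsCompleteIsometry Ψ)
    (hφ : IsCCP φ) : regKernel (WeakDual ℂ Y) ≤ LinearMap.ker φ := by
  intro f hf
  refine h1.injective (ext_compress fun m w hw => ?_)
  rw [map_zero, map_zero]
  exact regKernel_le ((isCCP_compress hw).comp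
    ((isCCP_of_isCompleteOrderMono h1 h2 fun _ _ hx => hx.1).comp hφ)) hf

theorem isCCP_regLift_dual (h1 : IsCompleteOrderMono Ψ) (h2 : IsCompleteIsometry Ψ)
    (hφ : IsCCP φ) : IsCCP (regLift φ (regKernel_le_ker_of_isCCP h1 h2 hφ)) := by
  refine isCCP_of_compress h1 h2
    (conjTranspose_eq_of_mem_matCone_regularization fun _ _ hx => hx.1)
    (fun n x => matNorm_regularization_nonneg x) fun m w hw => ?_
  have h := (isCCP_compress hw).comp
    ((isCCP_of_isCompleteOrderMono h1 h2 fun _ _ hx => hx.1).comp hφ)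
  have heq : compress w ∘ₗ Ψ ∘ₗ regLift φ (regKernel_le_ker_of_isCCP h1 h2 hφ) =
      regLift _ (regKernel_le h) :=
    LinearMap.ext fun x => by
      obtain ⟨y, rfl⟩ := toRegularization_surjective x
      rfl
  rw [heq]
  exact isCCP_regLift h

/-- Weak*-continuous maps into a dual operator system extend to the universal dual: evaluation at
an element of the predual is a combination of ultraweak functionals, hence pulls back to the predual
of `N(Y^*)`. -/
theorem exists_extension [CompleteSpace Z] (h1 : IsCompleteOrderMono Ψ)
    (h2 : IsCompleteIsometry Ψ)
    (h3 : @Topology.IsEmbedding _ _ inferInstance (ultraweakTopology H) Ψ) (hφ : IsCCPw φ) :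
    ∃ φb : UniversalDual Y →ₗ[ℂ] WeakDual ℂ Z, Continuous φb ∧ φb ∘ₗ iotaMap Y = φ := by
  refine exists_continuous_extension φ fun z => ?_
  let G : Submodule ℂ (WeakDual ℂ Z →ₗ[ℂ] ℂ) :=
    { carrier := {g | ∃ ω : NPredual Y, ∀ f, g (φ f) = nPairing Y (muMap Y f) ω}
      add_mem' := by
        rintro g g' ⟨ω, hω⟩ ⟨ω', hω'⟩
        exact ⟨ω + ω', fun f => by rw [LinearMap.add_apply, hω, hω', map_add]⟩
      zero_mem' := ⟨0, fun f => by rw [LinearMap.zero_apply, map_zero]⟩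
      smul_mem' := by
        rintro c g ⟨ω, hω⟩
        exact ⟨c • ω, fun f => by rw [LinearMap.smul_apply, hω, map_smul]⟩ }
  let g : WeakDual ℂ Z →ₗ[ℂ] ℂ :=
    { toFun := fun v => v z, map_add' := fun _ _ => rfl, map_smul' := fun _ _ => rfl }
  have hg := mem_span_ultraweakFunctional
    (@Topology.IsEmbedding.toIsInducing _ _ _ (ultraweakTopology H) _ h3) g
    (WeakDual.eval_continuous z)
  have hle : Submodule.span ℂ (Set.range fun p => ultraweakFunctional (H := H) p ∘ₗ Ψ) ≤ G := by
    refine Submodule.span_le.2 ?_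
    rintro _ ⟨p, rfl⟩
    exact exists_predual_ultraweakFunctional (Φ := Ψ ∘ₗ φ) (fun m w hw =>
      isCCPw_compress_comp h1 h2
        (@Topology.IsEmbedding.continuous _ _ _ _ (ultraweakTopology H) h3) hφ hw) p
  exact hle hg

/-- A weak*-continuous extension of a completely positive complete contraction to the universal
dual is a completely positive complete contraction: its compressions are coordinates of `N(Y^*)`. -/
theorem isCCPw_of_comp_iotaMap (h1 : IsCompleteOrderMono Ψ) (h2 : IsCompleteIsometry Ψ)
    (h3 : @Continuous _ _ _ (ultraweakTopology H) Ψ) (hφ : IsCCPw φ)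
    {φb : UniversalDual Y →ₗ[ℂ] WeakDual ℂ Z} (hc : Continuous φb) (hφb : φb ∘ₗ iotaMap Y = φ) :
    IsCCPw φb := by
  refine ⟨isCCP_of_compress h1 h2 conjTranspose_eq_of_mem_matCone_universalDual
    (fun n x => matNorm_universalDual_nonneg x) fun m w hw => ?_, hc⟩
  let i : CCPwIndex Y := ⟨m, compress w ∘ₗ Ψ ∘ₗ φ, isCCPw_compress_comp h1 h2 h3 hφ hw⟩
  have heq : compress w ∘ₗ Ψ ∘ₗ φb = NAlg.coord Y i ∘ₗ (UniversalDual Y).subtype := by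
    refine ext_of_comp_iotaMap ((@Continuous.comp _ _ _ _ (ultraweakTopology H) _ _ _
      (continuous_compress w) h3).comp hc) (continuous_coord i) (LinearMap.ext fun f => ?_)
    exact congrArg (fun v => compress w (Ψ v)) (LinearMap.congr_fun hφb f)
  rw [heq]
  exact isCCP_coord i

end DualOperatorSystem

section Lifting

variable {Y : Type u} [NormedAddCommGroup Y] [NormedSpace ℂ Y] [StarAddMonoid Y]
  [StarModule ℂ Y] [NormedStarGroup Y] [SMOS Y]

theorem coord_eq_comp_of_lift {Z : Type v} [NormedAddCommGroup Z] [NormedSpace ℂ Z]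
    {φ : WeakDual ℂ Y →ₗ[ℂ] WeakDual ℂ Z}
    {φb : UniversalDual Y →ₗ[ℂ] WeakDual ℂ Z} (hc : Continuous φb) (hφb : φb ∘ₗ iotaMap Y = φ)
    (i : CCPwIndex Y) {ψ : WeakDual ℂ Z →ₗ[ℂ] Matrix (Fin i.1) (Fin i.1) ℂ} (hψ : Continuous ψ)
    (h : i.2.1 = ψ ∘ₗ φ) : NAlg.coord Y i ∘ₗ (UniversalDual Y).subtype = ψ ∘ₗ φb := by
  refine ext_of_comp_iotaMap (continuous_coord i) (hψ.comp hc) (LinearMap.ext fun f => ?_)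
  have h1 : i.2.1 f = ψ (φ f) := LinearMap.congr_fun h f
  exact h1.trans (congrArg ψ (LinearMap.congr_fun hφb f).symm)

variable {Z : Type v} [NormedAddCommGroup Z] [NormedSpace ℂ Z] [StarAddMonoid Z]
  [StarModule ℂ Z] [NormedStarGroup Z] [SMOS Z]

/-- If every coordinate of the universal dual factors through `φb`, then `φb` is an isomorphism onto
its image for all the structures involved. -/
theorem isEmbedding_of_coord_factor [CompleteSpace Z] {φb : UniversalDual Y →ₗ[ℂ] WeakDual ℂ Z}
    (hφb : IsCCPw φb)
    (h : ∀ i : CCPwIndex Y, ∃ ψ : WeakDual ℂ Z →ₗ[ℂ] Matrix (Fin i.1) (Fin i.1) ℂ, IsCCPw ψ ∧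
      NAlg.coord Y i ∘ₗ (UniversalDual Y).subtype = ψ ∘ₗ φb) :
    IsCompleteIsometry φb ∧ Topology.IsEmbedding φb ∧ IsCompleteOrderMono φb := by
  choose ψ hψ hcoord using h
  have hcoord' : ∀ i (x : UniversalDual Y), NAlg.coord Y i x.1 = ψ i (φb x) := fun i x =>
    LinearMap.congr_fun (hcoord i) x
  have hmap : ∀ i {n : ℕ} (x : Matrix (Fin n) (Fin n) (UniversalDual Y)),
      (x.map (UniversalDual Y).subtype).map (NAlg.coord Y i) = (x.map φb).map (ψ i) :=
    fun i n x => Matrix.ext fun k l => hcoord' i (x k l)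
  have hinj : Function.Injective φb := fun x y hxy =>
    Subtype.ext (NAlg.ext_coord fun i => by rw [hcoord', hcoord', hxy])
  refine ⟨fun n x => (hφb.matNorm_map_le n x).antisymm ?_, ⟨⟨?_⟩, hinj⟩, hφb.map_star, hinj,
    fun n x _ => ⟨fun hx i => ?_, hφb.map_matCone n x⟩⟩
  · refine Real.iSup_le (fun i => ?_) (matNorm_dual_nonneg _)
    rw [hmap]
    exact (hψ i).matNorm_map_le n _
  · refine le_antisymm hφb.continuous.le_induced ?_
    -- Every functional in the predual of `N(Y^*)` is evaluation of `φb` at an element of `Z`.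
    let t : TopologicalSpace (UniversalDual Y) := TopologicalSpace.induced φb inferInstance
    refine continuous_iff_le_induced.1 (WeakBilin.continuous_of_continuous_eval _ fun ω => ?_)
    have h1 : Summable fun i => ‖ω i‖ := by
      simpa using (lp.memℓp ω).summable (by simp)
    obtain ⟨z, hz⟩ := exists_eval_eq_tsum hψ h1
    refine ((WeakDual.eval_continuous z).comp (continuous_induced_dom (f := φb))).congr fun x => ?_
    exact (hz (φb x)).symm.trans (tsum_congr fun i => by rw [← hcoord' i x]; rfl)
  · rw [hmap]
    exact (hψ i).map_matCone n _ hx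

end Lifting

/-! ### Weak*-density of the positive cones -/

section Separation

/-- A point outside the closure of a convex cone is separated from the cone by a functional which is
nonnegative on the cone. -/
theorem exists_separating_functional {E : Type*} [TopologicalSpace E] [AddCommGroup E]
    [IsTopologicalAddGroup E] [Module ℂ E] [ContinuousSMul ℂ E] [Module ℝ E] [IsScalarTower ℝ ℂ E]
    [LocallyConvexSpace ℝ E] {C : Set E} (h0 : (0 : E) ∈ C)
    (hC : ∀ x ∈ C, ∀ y ∈ C, ∀ s t : ℝ, 0 ≤ s → 0 ≤ t → (s : ℂ) • x + (t : ℂ) • y ∈ C)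
    {x : E} (hx : x ∉ closure C) :
    ∃ g : StrongDual ℂ E, (g x).re < 0 ∧ ∀ b ∈ C, 0 ≤ (g b).re := by
  have : ContinuousSMul ℝ E := IsScalarTower.continuousSMul ℂ
  have hreal : ∀ (r : ℝ) (y : E), r • y = (r : ℂ) • y := fun r y => by
    rw [← algebraMap_smul ℂ r y]; rfl
  have hconv : Convex ℝ C := fun a ha b hb s t hs ht _ => by
    rw [hreal, hreal]
    exact hC a ha b hb s t hs ht
  obtain ⟨g, u, hgx, hgC⟩ := RCLike.geometric_hahn_banach_point_closed (𝕜 := ℂ)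
    hconv.closure isClosed_closure hx
  have hu : u < 0 := by simpa using hgC 0 (subset_closure h0)
  refine ⟨g, lt_trans hgx hu, fun b hb => le_of_not_gt fun hneg => ?_⟩
  -- Scaling `b` would make the functional attain the separating constant `u` on the cone.
  have ht : 0 ≤ u / (g b).re := (div_pos_of_neg_of_neg hu hneg).le
  have h1 := hgC _ (subset_closure (hC b hb 0 h0 (u / (g b).re) 0 ht le_rfl))
  rw [smul_zero, add_zero, map_smul, smul_eq_mul] at h1
  rw [RCLike.re_to_complex, Complex.re_ofReal_mul, div_mul_cancel₀ _ hneg.ne] at h1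
  exact lt_irrefl _ h1

theorem exists_entry_functionals {E : Type*} [TopologicalSpace E] [AddCommGroup E] [Module ℂ E]
    {n : ℕ} (g : StrongDual ℂ (Fin n → Fin n → E)) :
    ∃ γ : Fin n → Fin n → StrongDual ℂ E, ∀ x, g x = ∑ i, ∑ j, γ i j (x i j) := by
  refine ⟨fun i j => g.comp ((ContinuousLinearMap.single ℂ (fun _ : Fin n => Fin n → E) i).comp
    (ContinuousLinearMap.single ℂ (fun _ : Fin n => E) j)), fun x => ?_⟩
  conv_lhs => rw [← Finset.univ_sum_single x]
  rw [map_sum]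
  refine Finset.sum_congr rfl fun i _ => ?_
  conv_lhs => rw [← Finset.univ_sum_single (x i)]
  have h : (Pi.single i (∑ j, Pi.single j (x i j)) : Fin n → Fin n → E) =
      ∑ j, Pi.single i (Pi.single j (x i j)) :=
    map_sum (AddMonoidHom.single (fun _ : Fin n => Fin n → E) i) _ _
  rw [h, map_sum]
  rfl

/-- Separation of a matrix over `E` from a cone of matrices, for the topology of entrywise
convergence. -/
theorem exists_separating_entry_functionals {E : Type*} [TopologicalSpace E] [AddCommGroup E]
    [IsTopologicalAddGroup E] [Module ℂ E] [ContinuousSMul ℂ E] [Module ℝ E] [IsScalarTower ℝ ℂ E]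
    [LocallyConvexSpace ℝ E] {n : ℕ} {C : Set (Matrix (Fin n) (Fin n) E)} (h0 : 0 ∈ C)
    (hC : ∀ x ∈ C, ∀ y ∈ C, ∀ s t : ℝ, 0 ≤ s → 0 ≤ t → (s : ℂ) • x + (t : ℂ) • y ∈ C)
    {x : Matrix (Fin n) (Fin n) E} (hx : x ∉ closure C) :
    ∃ γ : Fin n → Fin n → StrongDual ℂ E, (∑ i, ∑ j, γ i j (x i j)).re < 0 ∧
      ∀ b ∈ C, 0 ≤ (∑ i, ∑ j, γ i j (b i j)).re := by
  let C' : Set (Fin n → Fin n → E) := C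
  have separate := exists_separating_functional (C := C')
  obtain ⟨g, hgx, hg⟩ := separate h0 hC hx
  obtain ⟨γ, hγ⟩ := exists_entry_functionals g
  exact ⟨γ, hγ x ▸ hgx, fun b hb => hγ b ▸ hg b hb⟩

theorem sum_add_star_apply {E : Type*} [TopologicalSpace E] [AddCommGroup E] [Module ℂ E]
    [Star E] {n : ℕ} (γ : Fin n → Fin n → StrongDual ℂ E) {x : Matrix (Fin n) (Fin n) E}
    (hx : xᴴ = x) : ∑ k, ∑ l, (γ k l (x k l) + star (γ l k (star (x k l)))) =
      ((2 * (∑ i, ∑ j, γ i j (x i j)).re : ℝ) : ℂ) := by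
  have hxstar : ∀ k l, star (x k l) = x l k := fun k l =>
    (Matrix.conjTranspose_apply x k l).symm.trans (congrFun (congrFun hx l) k)
  have h1 : ∑ k, ∑ l, star (γ l k (x l k)) = star (∑ i, ∑ j, γ i j (x i j)) := by
    rw [Finset.sum_comm, star_sum]
    exact Finset.sum_congr rfl fun i _ => (star_sum _ _).symm
  simp only [hxstar, Finset.sum_add_distrib]
  rw [h1, Complex.star_def, Complex.add_conj]

end Separation

section Bipolar

variable {Y : Type u} [NormedAddCommGroup Y] [NormedSpace ℂ Y] [StarAddMonoid Y]
  [StarModule ℂ Y] [NormedStarGroup Y]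

theorem star_weakDual_apply (f : WeakDual ℂ Y) (y : Y) : star f y = star (f (star y)) := rfl

/-- Pairing the symmetrization of `f` with a self-adjoint matrix. -/
theorem sum_add_conjTranspose_apply {n : ℕ} (f : Matrix (Fin n) (Fin n) (WeakDual ℂ Y))
    {x : Matrix (Fin n) (Fin n) Y} (hx : xᴴ = x) :
    ∑ i, ∑ j, (f + fᴴ) i j (x i j) = ((2 * (∑ i, ∑ j, f i j (x i j)).re : ℝ) : ℂ) := by
  have h : ∑ i, ∑ j, (fᴴ) i j (x i j) = star (∑ i, ∑ j, f i j (x i j)) := by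
    rw [Finset.sum_comm, star_sum]
    refine Finset.sum_congr rfl fun i _ => ?_
    rw [star_sum]
    refine Finset.sum_congr rfl fun j _ => ?_
    rw [Matrix.conjTranspose_apply, star_weakDual_apply, ← Matrix.conjTranspose_apply x, hx]
  calc ∑ i, ∑ j, (f + fᴴ) i j (x i j)
      = ∑ i, ∑ j, f i j (x i j) + ∑ i, ∑ j, (fᴴ) i j (x i j) := by
        rw [← Finset.sum_add_distrib]
        refine Finset.sum_congr rfl fun i _ => ?_
        rw [← Finset.sum_add_distrib]
        rfl
    _ = _ := by
        rw [h, Complex.star_def, Complex.add_conj]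

/-- Pairing a self-adjoint matrix of functionals with the symmetrization of `y`. -/
theorem sum_apply_add_conjTranspose {n : ℕ} {f : Matrix (Fin n) (Fin n) (WeakDual ℂ Y)}
    (hf : fᴴ = f) (y : Matrix (Fin n) (Fin n) Y) :
    ∑ i, ∑ j, f i j ((y + yᴴ) i j) = ((2 * (∑ i, ∑ j, f i j (y i j)).re : ℝ) : ℂ) := by
  have h : ∑ i, ∑ j, f i j (yᴴ i j) = star (∑ i, ∑ j, f i j (y i j)) := by
    rw [Finset.sum_comm, star_sum]
    refine Finset.sum_congr rfl fun i _ => ?_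
    rw [star_sum]
    refine Finset.sum_congr rfl fun j _ => ?_
    conv_lhs => rw [← hf]
    rw [Matrix.conjTranspose_apply, star_weakDual_apply, Matrix.conjTranspose_apply, star_star]
  simp only [Matrix.add_apply, map_add, Finset.sum_add_distrib]
  rw [h, Complex.star_def, Complex.add_conj]

variable [SMOS Y]

/-- A self-adjoint matrix of functionals which is nonnegative on the cone of the same size is
completely positive: a quadratic form of `matEval f x` is the pairing of `f` with a compression of
`x` to `M_n(Y)`. -/
theorem mem_matCone_dual {n : ℕ} {f : Matrix (Fin n) (Fin n) (WeakDual ℂ Y)} (hf : fᴴ = f)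
    (h : ∀ x ∈ (matCone n : Set (Matrix (Fin n) (Fin n) Y)), 0 ≤ ∑ i, ∑ j, f i j (x i j)) :
    f ∈ matCone n := by
  refine ⟨hf, fun m x hx => (posSemidef_iff_inner_nonneg _).2 fun a => ?_⟩
  rw [inner_matEval]
  exact h _ (sandwich_mem_matCone hx (Matrix.of fun k i => a (k, i)))

theorem isClosed_matCone (n : ℕ) :
    IsClosed (matCone n : Set (Matrix (Fin n) (Fin n) Y)) := by
  change IsClosed {x : Fin n → Fin n → Y | Matrix.of x ∈ matCone n}
  refine isClosed_of_closure_subset fun x hx => SMOS.matCone_closed n _ fun ε hε => ?_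
  have hpos : (0 : ℝ) < n * n + 1 := by positivity
  obtain ⟨y, hy, hxy⟩ := Metric.mem_closure_iff.1 hx (ε / (n * n + 1)) (by positivity)
  refine ⟨Matrix.of y, hy, (matNorm_le_sum_norm _).trans_lt ?_⟩
  rw [dist_eq_norm] at hxy
  calc ∑ i, ∑ j, ‖(Matrix.of x - Matrix.of y) i j‖ ≤ ∑ _i : Fin n, ∑ _j : Fin n, ‖x - y‖ :=
        Finset.sum_le_sum fun i _ => Finset.sum_le_sum fun j _ =>
          (norm_le_pi_norm ((x - y) i) j).trans (norm_le_pi_norm (x - y) i)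
    _ = n * n * ‖x - y‖ := by simp [mul_assoc]
    _ ≤ (n * n + 1) * ‖x - y‖ := by gcongr; linarith
    _ < (n * n + 1) * (ε / (n * n + 1)) := by gcongr
    _ = ε := by field_simp

/-- The bipolar theorem for the cone `M_n(Y)_+`. -/
theorem mem_matCone_of_dual {n : ℕ} {y : Matrix (Fin n) (Fin n) Y} (hy : yᴴ = y)
    (h : ∀ f ∈ (matCone n : Set (Matrix (Fin n) (Fin n) (WeakDual ℂ Y))),
      0 ≤ (∑ i, ∑ j, f i j (y i j)).re) : y ∈ matCone n := by
  by_contra hcon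
  obtain ⟨γ, hγy, hγ⟩ := exists_separating_entry_functionals
    (C := (matCone n : Set (Matrix (Fin n) (Fin n) Y))) (x := y) (SMOS.zero_mem_matCone n)
    (fun a ha b hb s t hs ht => add_smul_mem_matCone ha hb hs ht)
    (by rw [(isClosed_matCone n).closure_eq]; exact hcon)
  let f : Matrix (Fin n) (Fin n) (WeakDual ℂ Y) :=
    Matrix.of fun i j => StrongDual.toWeakDual (γ i j)
  have hf : ∀ x : Matrix (Fin n) (Fin n) Y, xᴴ = x →
      ∑ i, ∑ j, (f + fᴴ) i j (x i j) = ((2 * (∑ i, ∑ j, γ i j (x i j)).re : ℝ) : ℂ) :=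
    fun x hx => sum_add_conjTranspose_apply f hx
  have hpos : f + fᴴ ∈ matCone n := by
    refine mem_matCone_dual ?_ fun x hx => ?_
    · rw [Matrix.conjTranspose_add, Matrix.conjTranspose_conjTranspose, add_comm]
    · rw [hf x (SMOS.star_eq_of_mem_matCone n x hx), Complex.zero_le_real]
      exact mul_nonneg zero_le_two (hγ x hx)
  have h1 := h _ hpos
  rw [hf y hy, Complex.ofReal_re] at h1
  linarith

theorem add_smul_mem_matCone_dual {n : ℕ} {f f' : Matrix (Fin n) (Fin n) (WeakDual ℂ Y)}
    (hf : f ∈ matCone n) (hf' : f' ∈ matCone n) {s t : ℝ} (hs : 0 ≤ s) (ht : 0 ≤ t) :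
    (s : ℂ) • f + (t : ℂ) • f' ∈ matCone n := by
  have hstar : ∀ (r : ℝ) (F : Matrix (Fin n) (Fin n) (WeakDual ℂ Y)),
      ((r : ℂ) • F)ᴴ = (r : ℂ) • Fᴴ := fun r F => by
    refine Matrix.ext fun i j => DFunLike.ext _ _ fun y => ?_
    change star ((r : ℂ) * F j i (star y)) = (r : ℂ) * star (F j i (star y))
    simp
  refine ⟨by rw [Matrix.conjTranspose_add, hstar, hstar, hf.1, hf'.1], fun m x hx => ?_⟩
  exact ((hf.2 m x hx).smul (Complex.zero_le_real.2 hs)).add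
    ((hf'.2 m x hx).smul (Complex.zero_le_real.2 ht))

end Bipolar

section MatrixEvaluation

theorem l2_opNorm_submatrix_equiv_le {ι κ : Type*} [Fintype ι] [DecidableEq ι] [Fintype κ]
    [DecidableEq κ] (A : Matrix κ κ ℂ) (e : ι ≃ κ) : ‖A.submatrix e e‖ ≤ ‖A‖ := by
  refine opNorm_le_of_norm_inner_le (Matrix.toEuclideanCLM (𝕜 := ℂ) (A.submatrix e e))
    (norm_nonneg _) fun a b => ?_
  have h : inner ℂ a (Matrix.toEuclideanCLM (𝕜 := ℂ) (A.submatrix e e) b) =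
      inner ℂ (WithLp.toLp 2 fun q => a (e.symm q) : EuclideanSpace ℂ κ)
        (Matrix.toEuclideanCLM (𝕜 := ℂ) A (WithLp.toLp 2 fun q => b (e.symm q))) := by
    rw [inner_toEuclideanCLM_eq_sum, inner_toEuclideanCLM_eq_sum]
    refine Fintype.sum_equiv e _ _ fun p => Fintype.sum_equiv e _ _ fun q => ?_
    simp
  rw [h]
  refine (norm_inner_apply_le _ _ _).trans ?_
  exact mul_le_mul (mul_le_mul_of_nonneg_left (norm_comp_injective_le a e.symm.injective)
    (norm_nonneg _)) (norm_comp_injective_le b e.symm.injective) (norm_nonneg _)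
    (mul_nonneg (norm_nonneg _) (norm_nonneg _))

variable {Y : Type u} [NormedAddCommGroup Y] [NormedSpace ℂ Y]

/-- The map `Y^* → M_n`, `f ↦ (f(y_ij))`, given by `y ∈ M_n(Y)`. -/
noncomputable def evalMatrix {n : ℕ} (y : Matrix (Fin n) (Fin n) Y) :
    WeakDual ℂ Y →ₗ[ℂ] Matrix (Fin n) (Fin n) ℂ where
  toFun f := Matrix.of fun i j => f (y i j)
  map_add' _ _ := rfl
  map_smul' _ _ := rfl

/-- Positive elements of the unit ball of `M_n(Y)` give coordinates of `N(Y^*)`. -/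
theorem isCCPw_evalMatrix [StarAddMonoid Y] [StarModule ℂ Y] [NormedStarGroup Y] [SMOS Y] {n : ℕ}
    {y : Matrix (Fin n) (Fin n) Y} (hy : y ∈ matCone n) (hy1 : matNorm n y ≤ 1) :
    IsCCPw (evalMatrix y) where
  map_star f := by
    refine Matrix.ext fun i j => ?_
    change star (f (star (y i j))) = star (f (y j i))
    rw [← Matrix.conjTranspose_apply y, SMOS.star_eq_of_mem_matCone n y hy]
  map_matCone m f hf := (hf.2 n y hy).submatrix Prod.swap
  matNorm_map_le m f :=
    (l2_opNorm_submatrix_equiv_le (matEval f y) (Equiv.prodComm _ _)).trans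
      (norm_matEval_le_matNorm f hy1)
  continuous := continuous_matrix fun i j => WeakDual.eval_continuous (y i j)

end MatrixEvaluation

section Density

variable {Y : Type u} [NormedAddCommGroup Y] [NormedSpace ℂ Y] [StarAddMonoid Y]
  [StarModule ℂ Y] [NormedStarGroup Y] [SMOS Y]

instance locallyConvexSpace_universalDual : LocallyConvexSpace ℝ (UniversalDual Y) :=
  Topology.IsInducing.locallyConvexSpace (𝕜 := ℝ)
    (f := (UniversalDual Y).subtype.restrictScalars ℝ) Topology.IsInducing.subtypeVal

theorem continuous_star_universalDual :
    Continuous (star : UniversalDual Y → UniversalDual Y) :=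
  ((NAlg.continuous_star Y).comp continuous_subtype_val).subtype_mk _

/-- The quadratic form of `A` at the vector `∑ₖ eₖ ⊗ eₖ`. -/
theorem sum_diagonal_blocks_nonneg {n : ℕ} {A : Matrix (Fin n) (Fin n) (Matrix (Fin n) (Fin n) ℂ)}
    (hA : A ∈ matCone n) : 0 ≤ ∑ k, ∑ l, A k l k l := by
  have h := (posSemidef_iff_inner_nonneg _).1 hA (WithLp.toLp 2 fun p => if p.1 = p.2 then 1 else 0)
  rw [inner_toEuclideanCLM_eq_sum] at h
  simpa [Fintype.sum_prod_type, Matrix.comp_apply, apply_ite] using h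

theorem zero_mem_matCone_dual (n : ℕ) :
    (0 : Matrix (Fin n) (Fin n) (WeakDual ℂ Y)) ∈ matCone n :=
  ⟨Matrix.conjTranspose_zero, fun _ _ _ => Matrix.PosSemidef.zero⟩

/-- If `z` is positive in the unit ball of `M_n(Y)` and `G k l` extends evaluation at `z k l` to the
universal dual, then by density the `G k l` are the entries of the coordinate of `N(Y^*)` at
`evalMatrix z`, so that they pair nonnegatively with positive elements. -/
theorem sum_nonneg_of_eval {n : ℕ} {z : Matrix (Fin n) (Fin n) Y} (hz : z ∈ matCone n)
    (hz1 : matNorm n z ≤ 1) (x : Matrix (Fin n) (Fin n) (UniversalDual Y)) (hx : x ∈ matCone n)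
    (G : Fin n → Fin n → UniversalDual Y → ℂ) (hG : ∀ k l, Continuous (G k l))
    (hGz : ∀ k l f, G k l (iotaMap Y f) = f (z k l)) : 0 ≤ ∑ k, ∑ l, G k l (x k l) := by
  have hcoord : ∀ (k l : Fin n) (v : UniversalDual Y),
      NAlg.coord Y ⟨n, evalMatrix z, isCCPw_evalMatrix hz hz1⟩ v.1 k l = G k l v := fun k l =>
    congrFun (denseRange_iotaMap.equalizer
      ((continuous_coord ⟨n, evalMatrix z, isCCPw_evalMatrix hz hz1⟩).matrix_elem k l) (hG k l)
      (funext fun f => (hGz k l f).symm))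
  have h := sum_diagonal_blocks_nonneg (hx ⟨n, evalMatrix z, isCCPw_evalMatrix hz hz1⟩)
  have heq : ∑ k, ∑ l, G k l (x k l) = ∑ k, ∑ l, ((x.map (UniversalDual Y).subtype).map
      (NAlg.coord Y ⟨n, evalMatrix z, isCCPw_evalMatrix hz hz1⟩)) k l k l :=
    Finset.sum_congr rfl fun k _ => Finset.sum_congr rfl fun l _ => (hcoord k l (x k l)).symm
  rw [heq]
  exact h

/-- A separating functional restricts to an element of `M_n(Y)` whose symmetrization is positive by
the bipolar theorem, hence defines, up to scaling, a coordinate of `N(Y^*)`. Positivity of this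
coordinate contradicts separation. -/
theorem matCone_subset_closure [CompleteSpace Y] (n : ℕ) :
    (matCone n : Set (Matrix (Fin n) (Fin n) (UniversalDual Y))) ⊆
      closure ((fun f : Matrix (Fin n) (Fin n) (WeakDual ℂ Y) => f.map (iotaMap Y)) ''
        matCone n) := by
  intro x hx
  by_contra hcon
  obtain ⟨γ, hγx, hγ⟩ := exists_separating_entry_functionals
    (C := (fun f : Matrix (Fin n) (Fin n) (WeakDual ℂ Y) => f.map (iotaMap Y)) '' matCone n)
    (x := x)
    ⟨0, zero_mem_matCone_dual n, Matrix.ext fun i j => map_zero (iotaMap Y)⟩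
    (by
      rintro _ ⟨f, hf, rfl⟩ _ ⟨f', hf', rfl⟩ s t hs ht
      exact ⟨_, add_smul_mem_matCone_dual hf hf' hs ht, Matrix.ext fun i j =>
        (map_add (iotaMap Y) ((s : ℂ) • f i j) ((t : ℂ) • f' i j)).trans
          (congrArg₂ (· + ·) (map_smul (iotaMap Y) (s : ℂ) (f i j))
            (map_smul (iotaMap Y) (t : ℂ) (f' i j)))⟩) hcon
  choose y hy using fun i j => exists_eval_of_continuous ((γ i j).toLinearMap ∘ₗ iotaMap Y)
    ((γ i j).continuous.comp continuous_iotaMap)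
  let z : Matrix (Fin n) (Fin n) Y := Matrix.of y + (Matrix.of y)ᴴ
  have hz : z ∈ matCone n := by
    refine mem_matCone_of_dual ?_ fun f hf => ?_
    · rw [Matrix.conjTranspose_add, Matrix.conjTranspose_conjTranspose, add_comm]
    · rw [sum_apply_add_conjTranspose hf.1, Complex.ofReal_re]
      refine mul_nonneg zero_le_two ?_
      have h1 := hγ _ ⟨f, hf, rfl⟩
      have h2 : ∑ i, ∑ j, γ i j (f.map (iotaMap Y) i j) = ∑ i, ∑ j, f i j (y i j) :=
        Finset.sum_congr rfl fun i _ => Finset.sum_congr rfl fun j _ => hy i j (f i j)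
      exact h2 ▸ h1
  -- Adding `1` avoids a division by zero when `z = 0`.
  let r : ℝ := (matNorm n z + 1)⁻¹
  have hN : 0 < matNorm n z + 1 := by linarith [matNorm_nonneg z]
  have hr : 0 < r := inv_pos.2 hN
  have hz' : (r : ℂ) • z ∈ matCone n := by
    simpa using add_smul_mem_matCone hz hz hr.le le_rfl
  have hz1 : matNorm n ((r : ℂ) • z) ≤ 1 := by
    rw [SMOS.matNorm_smul, Complex.norm_real, Real.norm_of_nonneg hr.le,
      inv_mul_le_one₀ hN]
    linarith
  -- The involution makes the extension of evaluation at `y l k` into one at `star (y l k)`.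
  have hpos := sum_nonneg_of_eval hz' hz1 x hx
    (fun k l v => (r : ℂ) * (γ k l v + star (γ l k (star v))))
    (fun k l => continuous_const.mul ((γ k l).continuous.add
        ((γ l k).continuous.comp continuous_star_universalDual).star)) fun k l f => by
      have h1 : γ k l (iotaMap Y f) = f (y k l) := hy k l f
      have h2 : γ l k (star (iotaMap Y f)) = star f (y l k) := by
        rw [← isCCP_iotaMap.map_star]; exact hy l k (star f)
      change (r : ℂ) * (γ k l (iotaMap Y f) + star (γ l k (star (iotaMap Y f)))) =
        f ((r : ℂ) • (y k l + star (y l k)))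
      rw [h1, h2, star_weakDual_apply, star_star, map_smul, map_add, smul_eq_mul]
  simp only [← Finset.mul_sum] at hpos
  rw [sum_add_star_apply γ (conjTranspose_eq_of_mem_matCone_universalDual n x hx),
    ← Complex.ofReal_mul, Complex.zero_le_real] at hpos
  nlinarith

end Density

theorem mainTheorem2 (Y : Type u) [NormedAddCommGroup Y] [NormedSpace ℂ Y] [StarAddMonoid Y]
    [StarModule ℂ Y] [NormedStarGroup Y] [SMOS Y] [CompleteSpace Y] :
    (∀ (Z : Type v) [NormedAddCommGroup Z] [NormedSpace ℂ Z] [StarAddMonoid Z]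
        [StarModule ℂ Z] [NormedStarGroup Z] [SMOS Z] [CompleteSpace Z],
      IsDualOperatorSystem.{v, w} Z →
      ∀ φ : WeakDual ℂ Y →ₗ[ℂ] WeakDual ℂ Z, IsCCPw φ →
      ∃ (φr : Regularization (WeakDual ℂ Y) →ₗ[ℂ] WeakDual ℂ Z)
        (φb : UniversalDual Y →ₗ[ℂ] WeakDual ℂ Z),
        -- the induced map on the regularization
        (IsCCP φr ∧ φr ∘ₗ toRegularization (WeakDual ℂ Y) = φ ∧
          (∀ χ : Regularization (WeakDual ℂ Y) →ₗ[ℂ] WeakDual ℂ Z,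
            χ ∘ₗ toRegularization (WeakDual ℂ Y) = φ → χ = φr) ∧
          Continuous[TopologicalSpace.induced (regToUniversalDual Y) inferInstance,
            inferInstance] φr) ∧
        -- its unique weak*-continuous extension to the universal dual
        (IsCCPw φb ∧ φb ∘ₗ regToUniversalDual Y = φr ∧ φb ∘ₗ iotaMap Y = φ ∧
          (∀ χ : UniversalDual Y →ₗ[ℂ] WeakDual ℂ Z,
            Continuous χ → χ ∘ₗ iotaMap Y = φ → χ = φb)) ∧
        -- the case where all maps to matrix algebras lift
        ((∀ (n : ℕ) (ψ : WeakDual ℂ Y →ₗ[ℂ] Matrix (Fin n) (Fin n) ℂ), IsCCPw ψ →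
            ∃ ψh : WeakDual ℂ Z →ₗ[ℂ] Matrix (Fin n) (Fin n) ℂ, IsCCPw ψh ∧ ψ = ψh ∘ₗ φ) →
          IsCompleteIsometry φb ∧ Topology.IsEmbedding φb ∧ IsCompleteOrderMono φb)) ∧
    -- weak*-density of the positive cones
    (∀ n : ℕ,
      (fun f : Matrix (Fin n) (Fin n) (WeakDual ℂ Y) => f.map (iotaMap Y)) ''
          MatrixOrderedData.matCone n ⊆ MatrixOrderedData.matCone n ∧
      (MatrixOrderedData.matCone n : Set (Matrix (Fin n) (Fin n) (UniversalDual Y))) ⊆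
        closure ((fun f : Matrix (Fin n) (Fin n) (WeakDual ℂ Y) => f.map (iotaMap Y)) ''
          MatrixOrderedData.matCone n)) := by
  refine ⟨fun Z _ _ _ _ _ _ _ hZ φ hφ => ?_,
    fun n => ⟨image_iotaMap_subset_matCone n, matCone_subset_closure n⟩⟩
  · obtain ⟨H, _, _, _, Ψ, h1, h2, h3⟩ := hZ
    obtain ⟨φb, hc, hφb⟩ := exists_extension h1 h2 h3 hφ
    have hΨ : @Continuous _ _ _ (ultraweakTopology H) Ψ :=
      @Topology.IsEmbedding.continuous _ _ _ _ (ultraweakTopology H) h3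
    have hccp : IsCCPw φb := isCCPw_of_comp_iotaMap h1 h2 hΨ hφ hc hφb
    have hker := regKernel_le_ker_of_isCCP h1 h2 hφ.toIsCCP
    have hreg := regLift_toRegularization φ hker
    have huniq : ∀ χ : Regularization (WeakDual ℂ Y) →ₗ[ℂ] WeakDual ℂ Z,
        χ ∘ₗ toRegularization (WeakDual ℂ Y) = φ → χ = regLift φ hker := fun χ hχ =>
      LinearMap.ext fun x => by
        obtain ⟨f, rfl⟩ := toRegularization_surjective x
        exact LinearMap.congr_fun (hχ.trans hreg.symm) f
    have hfactor : φb ∘ₗ regToUniversalDual Y = regLift φ hker := huniq _ hφb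
    refine ⟨regLift φ hker, φb, ⟨isCCP_regLift_dual h1 h2 hφ.toIsCCP, hreg, huniq, ?_⟩,
      ⟨hccp, hfactor, hφb, fun χ hχ hχφ => ext_of_comp_iotaMap hχ hc (hχφ.trans hφb.symm)⟩,
      fun hlift => isEmbedding_of_coord_factor hccp fun i => ?_⟩
    · rw [← hfactor]
      let t := TopologicalSpace.induced (regToUniversalDual Y) inferInstance
      have hκ : Continuous (regToUniversalDual Y) := continuous_induced_dom
      exact hc.comp hκ
    · obtain ⟨ψ, hψ, hψφ⟩ := hlift i.1 i.2.1 i.2.2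
      exact ⟨ψ, hψ, coord_eq_comp_of_lift hc hφb i hψ.continuous hψφ⟩
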